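/- Let $\mathbb F=\mathbb Q(q,t)$, where $q,t$ are formal variables, and let $N\ge1$. Let $\mathbb Y(N)$ be the set of partitions $\mu=(\mu_1\ge\dots\ge\mu_N\ge0)$, $|\mu|=\sum_i\mu_i$, and for $\mu\in\mathbb Y(N)$ put $X_N(\mu)=(q^{-\mu_1},q^{-\mu_2}t,\dots,q^{-\mu_N}t^{N-1})\in\mathbb F^N$. For every $\mu\in\mathbb Y(N)$ there is a symmetric polynomial $I_{\mu|N}(x_1,\dots,x_N;q,t)$ over $\mathbb F$, unique up to a nonzero scalar factor (the interpolation Macdonald polynomial), such that $\deg I_{\mu|N}=|\mu|$, $I_{\mu|N}(X_N(\lambda))=0$ for all $\lambda\in\mathbb Y(N)$ with $\lambda\ne\mu$ and $|\lambda|\le|\mu|$, and $I_{\mu|N}(X_N(\mu))\ne0$. On the field $\mathbb F(x_1,\dots,x_N)$ of rational functions, let $T_{q,x_j}$ be the $q$-shift replacing $x_j$ by $qx_j$, let $V=\prod_{i<j}(x_i-x_j)$, let $z$ be an auxiliary formal variable commuting with all operators, and let $$D_N(z;q,t)=\frac1{V}\,\det\Big[x_j^{-1}\big\{(x_jt^{1-N}-1)\,x_j^{N-i}t^{N-i}\,z\,T_{q,x_j}+(x_j+z)\,x_j^{N-i}\big\}\Big]_{i,j=1}^N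 ,$$ where the determinant is $\det[M_{ij}]=\sum_\sigma\operatorname{sgn}(\sigma)M_{\sigma(1),1}\cdots M_{\sigma(N),N}$ (entries from different columns commute). Then for every $\mu\in\mathbb Y(N)$ $$D_N(z;q,t)\,I_{\mu|N}(x_1,\dots,x_N;q,t)=\prod_{i=1}^N\big(1+q^{\mu_i}t^{1-i}z\big)\cdot I_{\mu|N}(x_1,\dots,x_N;q,t).$$ Moreover, $D_N(z;q,t)=1+\sum_{r=1}^N D^r_N(q,t)\,z^r$, where the $D^r_N(q,t)$ are operators on $\mathbb F(x_1,\dots,x_N)$ not depending on $z$, and the operators $D^1_N(q,t),\dots,D^N_N(q,t)$ commute with each other. -/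

import Mathlib

noncomputable section

namespace InterpMacdonald

open MvPolynomial

/-! ### The base field `ℚ(q, t)` -/

/-- The field `ℚ(q, t)` of rational functions in two formal variables. -/
abbrev QT : Type := FractionRing (MvPolynomial (Fin 2) ℚ)

/-- The variable `q`, as a nonzero element of `ℚ(q, t)`. -/
def qv : QTˣ :=
  Units.mk0 (algebraMap (MvPolynomial (Fin 2) ℚ) QT (X 0)) (by
    rw [Ne, FaithfulSMul.algebraMap_eq_zero_iff]
    exact X_ne_zero 0)

/-- The variable `t` of `ℚ(q, t)`. -/
def tv : QT := algebraMap (MvPolynomial (Fin 2) ℚ) QT (X 1)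

/-! ### Interpolation Macdonald polynomials

A partition with at most `N` parts is a weakly decreasing function `μ : Fin N → ℕ`;
its size `|μ|` is `∑ i, μ i`.  Indices are counted from `0`, so that the `i` of the usual
formulas is `(i : ℕ) + 1`. -/

/-- The interpolation node `(q ^ (-μ₁), q ^ (-μ₂) t, …, q ^ (-μ_N) t ^ (N - 1))`. -/
def node {F : Type*} [Field F] (q : Fˣ) (t : F) {N : ℕ} (μ : Fin N → ℕ) : Fin N → F :=
  fun i => ((q : F) ^ μ i)⁻¹ * t ^ (i : ℕ)

/-- `f` is an interpolation Macdonald polynomial with index `μ` in `N` variables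
(this determines `f` up to a nonzero scalar factor). -/
structure IsInterpolation {F : Type*} [Field F] (q : Fˣ) (t : F) {N : ℕ}
    (μ : Fin N → ℕ) (f : MvPolynomial (Fin N) F) : Prop where
  symm : f.IsSymmetric
  degree : f.totalDegree = ∑ i, μ i
  vanish : ∀ ν : Fin N → ℕ, Antitone ν → ν ≠ μ → ∑ i, ν i ≤ ∑ i, μ i →
    eval (node q t ν) f = 0
  nonvanish : eval (node q t μ) f ≠ 0

/-! ### The `q`-shifts -/

/-- The field `F(x₁, …, x_N)` of rational functions. -/
abbrev RatF (F : Type*) [Field F] (N : ℕ) : Type _ := FractionRing (MvPolynomial (Fin N) F)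

/-- The variable `x_j` as a rational function. -/
def xv (F : Type*) [Field F] {N : ℕ} (j : Fin N) : RatF F N :=
  algebraMap (MvPolynomial (Fin N) F) (RatF F N) (X j)

/-- The substitution `x_j ↦ c x_j` on polynomials, the other variables being fixed. -/
def scaleVar {F : Type*} [Field F] {N : ℕ} (j : Fin N) (c : F) :
    MvPolynomial (Fin N) F →ₐ[F] MvPolynomial (Fin N) F :=
  aeval fun i => if i = j then C c * X i else X i

theorem scaleVar_comp {F : Type*} [Field F] {N : ℕ} (j : Fin N) (c d : F) (h : c * d = 1) :
    (scaleVar j c).comp (scaleVar j d) = AlgHom.id F (MvPolynomial (Fin N) F) := by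
  apply MvPolynomial.algHom_ext
  intro i
  by_cases hi : i = j
  · subst hi
    simp only [scaleVar, AlgHom.comp_apply, aeval_X, if_true, map_mul, algHom_C,
      AlgHom.id_apply, algebraMap_eq]
    rw [← mul_assoc, ← C_mul, mul_comm d c, h, C_1, one_mul]
  · simp [scaleVar, hi]

/-- The substitution `x_j ↦ q x_j` as an automorphism of the polynomial algebra. -/
def polyShift {F : Type*} [Field F] (q : Fˣ) {N : ℕ} (j : Fin N) :
    MvPolynomial (Fin N) F ≃ₐ[F] MvPolynomial (Fin N) F :=
  AlgEquiv.ofAlgHom (scaleVar j (q : F)) (scaleVar j ((q⁻¹ : Fˣ) : F))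
    (scaleVar_comp j _ _ q.mul_inv) (scaleVar_comp j _ _ q.inv_mul)

/-- The `q`-shift `T_{q, x_j}` on rational functions:
`f(x₁, …, x_N) ↦ f(x₁, …, q x_j, …, x_N)`. -/
def qShift {F : Type*} [Field F] (q : Fˣ) {N : ℕ} (j : Fin N) : Module.End F (RatF F N) :=
  (IsFractionRing.fieldEquivOfAlgEquiv F (RatF F N) (RatF F N)
    (polyShift q j)).toLinearMap

/-! ### The `q`-difference operators

Operators on rational functions depending polynomially on an auxiliary variable `z` are
elements of `Polynomial (Module.End F (RatF F N))`; the polynomial variable is `z`. -/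

/-- The operator of multiplication by a rational function. -/
def mulOp {F : Type*} [Field F] {N : ℕ} (g : RatF F N) : Module.End F (RatF F N) :=
  LinearMap.mulLeft F g

/-- The Vandermonde product `∏_{i < j} (x_i - x_j)`. -/
def vandermondeProd (F : Type*) [Field F] (N : ℕ) : RatF F N :=
  ∏ i : Fin N, ∏ j ∈ Finset.Ioi i, (xv F i - xv F j)

/-- The entry in row `i` and column `j` of the operator matrix,
`x_j⁻¹ {(x_j t ^ (1 - N) - 1) x_j ^ (N - i) t ^ (N - i) z T_{q, x_j} + (x_j + z) x_j ^ (N - i)}`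
with `i` counted from `1`. -/
def entry {F : Type*} [Field F] (q : Fˣ) (t : F) {N : ℕ} (i j : Fin N) :
    Polynomial (Module.End F (RatF F N)) :=
  let x : RatF F N := xv F j
  let τ : RatF F N := algebraMap F (RatF F N) t
  let m : ℕ := N - ((i : ℕ) + 1)
  Polynomial.C (mulOp x⁻¹) *
    (Polynomial.C (mulOp ((x * τ ^ (1 - (N : ℤ)) - 1) * x ^ m * τ ^ m)) * Polynomial.X *
        Polynomial.C (qShift q j) +
      (Polynomial.C (mulOp x) + Polynomial.X) * Polynomial.C (mulOp (x ^ m)))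

/-- The determinant `∑_σ sgn(σ) M_{σ(1), 1} M_{σ(2), 2} ⋯ M_{σ(N), N}` of a square matrix over
a ring in which entries from different columns commute. -/
def columnDet {R : Type*} [Ring R] {N : ℕ} (M : Fin N → Fin N → R) : R :=
  ∑ σ : Equiv.Perm (Fin N),
    ((Equiv.Perm.sign σ : ℤˣ) : ℤ) • (List.ofFn fun j => M (σ j) j).prod

/-- The `q`-difference operator `D_N(z; q, t)`, as a polynomial in `z`. -/
def opD {F : Type*} [Field F] (q : Fˣ) (t : F) (N : ℕ) :
    Polynomial (Module.End F (RatF F N)) :=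
  Polynomial.C (mulOp (vandermondeProd F N)⁻¹) * columnDet (entry q t (N := N))

/-- The `q`-difference operator `D^r_N(q, t)`, the coefficient of `z ^ r` in `D_N(z; q, t)`. -/
def opDr {F : Type*} [Field F] (q : Fˣ) (t : F) (N r : ℕ) : Module.End F (RatF F N) :=
  (opD q t N).coeff r

/-- The action of an operator depending polynomially on `z` on a rational function `f` (not
depending on `z`): a polynomial in `z` with coefficients in rational functions. -/
def applyOp {F : Type*} [Field F] {N : ℕ} (P : Polynomial (Module.End F (RatF F N)))
    (f : RatF F N) : Polynomial (RatF F N) :=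
  P.sum fun r a => Polynomial.monomial r (a f)

end InterpMacdonald

end

/-! Expand the column determinant by choosing in each column the term with or without `q`-shift. For
a choice `β` the result is a Vandermonde determinant in the variables `t x_j` (shifted columns) and
`x_j` (the others), so `D_N(z)` is a sum over `β` of an explicit rational function times the shift
by `q ^ β` (`opD_eq`).

For a symmetric polynomial `f` and a scalar `z`, the polynomial `numerator`, which is `V x₁ ⋯ x_N
D_N(z) f`, is antisymmetric and divisible by every `x_j`. Hence `D_N(z) f` is again a symmetric
polynomial, of degree at most `deg f` (`exists_numerator_eq`).

The shift by `q ^ β` moves the node of `μ` to the node of `μ - β`, and the coefficient vanishes at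
the node whenever `μ - β` is not a partition. So the value of `D_N(z) f` at `μ` only involves values
of `f` at partitions contained in `μ` (`eval_node_numerator`). The vanishing conditions therefore
survive, and the term without shifts gives the eigenvalue `∏ (1 + z / x_i)` at the node. A symmetric
polynomial of degree at most `d` is determined by its values at the nodes of size at most `d`
(`eq_zero_of_eval_node`), which yields the eigenvalue equation as well as existence and uniqueness.

The interpolation polynomials span the symmetric polynomials, so commutators of the coefficients
kill all symmetric polynomials. A combination of shifts with this property is zero, by Dedekind's
independence of characters (`eq_zero_of_mem_shiftSpan`). -/

noncomputable section

namespace InterpMacdonald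

open MvPolynomial

/-! ### Substitutions and divisibility in polynomial rings -/

section Substitution

variable {F : Type*} [Field F] {σ : Type*}

/-- A factor theorem: `φ` is the identity modulo `d` on generators, hence everywhere. It is applied
when `φ p = 0`, to conclude `d ∣ p`. -/
theorem dvd_sub_algHom (φ : MvPolynomial σ F →ₐ[F] MvPolynomial σ F) (d : MvPolynomial σ F)
    (h : ∀ k, d ∣ X k - φ (X k)) (p : MvPolynomial σ F) : d ∣ p - φ p := by
  induction p using MvPolynomial.induction_on with
  | C a => simp [← algebraMap_eq]
  | add p r hp hr =>
    rw [map_add, add_sub_add_comm]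
    exact dvd_add hp hr
  | mul_X p k hp =>
    have : p * X k - φ (p * X k) = (p - φ p) * X k + φ p * (X k - φ (X k)) := by
      rw [map_mul]; ring
    rw [this]
    exact dvd_add (hp.mul_right _) ((h k).mul_left _)

theorem totalDegree_aeval_le {τ : Type*} (φ : σ → MvPolynomial τ F)
    (h : ∀ k, (φ k).totalDegree ≤ 1) (p : MvPolynomial σ F) :
    (aeval φ p).totalDegree ≤ p.totalDegree := by
  rw [aeval_def, eval₂_eq]
  refine totalDegree_finsetSum_le fun s hs => ?_
  refine (totalDegree_mul _ _).trans ?_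
  rw [algebraMap_eq, totalDegree_C, zero_add]
  refine (totalDegree_finsetProd _ _).trans ?_
  refine le_trans (Finset.sum_le_sum fun i _ => ?_) (le_totalDegree hs)
  refine (totalDegree_pow _ _).trans ?_
  simpa using Nat.mul_le_mul_left (s i) (h i)

theorem irreducible_of_totalDegree_one {p : MvPolynomial σ F} (hp : p.totalDegree = 1) :
    Irreducible p := by
  refine irreducible_of_totalDegree_eq_one hp fun x hx => ?_
  rw [isUnit_iff_ne_zero]
  rintro rfl
  have : p = 0 := by
    ext m
    simpa using hx m
  simp [this] at hp

theorem totalDegree_X_sub_C (i : σ) (a : F) :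
    (X i - C a : MvPolynomial σ F).totalDegree = 1 := by
  rw [sub_eq_add_neg, ← C_neg, totalDegree_add_eq_left_of_totalDegree_lt] <;> simp

theorem totalDegree_X_sub_X {i j : σ} (hij : i ≠ j) :
    (X i - X j : MvPolynomial σ F).totalDegree = 1 := by
  have h : (X i - X j : MvPolynomial σ F).IsHomogeneous 1 :=
    (isHomogeneous_X _ _).sub (isHomogeneous_X _ _)
  refine h.totalDegree ?_
  rw [sub_ne_zero]
  exact fun h => hij (X_injective h)

theorem isRelPrime_of_eval {p r : MvPolynomial σ F} (hp : p.totalDegree = 1) (x : σ → F)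
    (h0 : eval x p = 0) (h1 : eval x r ≠ 0) : IsRelPrime p r := by
  rw [(irreducible_of_totalDegree_one hp).isRelPrime_iff_not_dvd]
  rintro ⟨s, rfl⟩
  simp [h0] at h1

/-- The substitution `x_j ↦ c_j x_j` for all `j`. -/
def scale (c : σ → F) : MvPolynomial σ F →ₐ[F] MvPolynomial σ F :=
  aeval fun i => C (c i) * X i

@[simp]
theorem scale_X (c : σ → F) (i : σ) : scale c (X i) = C (c i) * X i := by
  simp [scale]

theorem scale_scale (c d : σ → F) (p : MvPolynomial σ F) :
    scale c (scale d p) = scale (c * d) p := by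
  rw [← AlgHom.comp_apply]
  congr 1
  apply MvPolynomial.algHom_ext
  intro i
  simp only [AlgHom.comp_apply, scale_X, map_mul, Pi.mul_apply]
  rw [← algebraMap_eq, AlgHom.commutes, algebraMap_eq]
  ring

theorem scale_one (p : MvPolynomial σ F) : scale 1 p = p := by
  have : scale (1 : σ → F) = AlgHom.id F _ := by
    apply MvPolynomial.algHom_ext
    intro i
    simp
  rw [this, AlgHom.id_apply]

theorem eval_scale (c x : σ → F) (p : MvPolynomial σ F) :
    eval x (scale c p) = eval (fun i => c i * x i) p := by
  have : (aeval x).comp (scale c) = aeval (R := F) (fun i => c i * x i) := by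
    apply MvPolynomial.algHom_ext
    intro i
    simp
  simpa [aeval_eq_eval] using DFunLike.congr_fun this p

theorem totalDegree_scale_le (c : σ → F) (p : MvPolynomial σ F) :
    (scale c p).totalDegree ≤ p.totalDegree := by
  refine totalDegree_aeval_le _ (fun k => (totalDegree_mul _ _).trans ?_) p
  simp

theorem rename_scale {τ : Type*} (e : σ ≃ τ) (c : σ → F) (p : MvPolynomial σ F) :
    rename e (scale c p) = scale (c ∘ e.symm) (rename e p) := by
  rw [← AlgHom.comp_apply, ← AlgHom.comp_apply]
  congr 1
  apply MvPolynomial.algHom_ext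
  intro i
  simp

theorem isSymmetric_scale_const (c : F) {p : MvPolynomial σ F} (hp : p.IsSymmetric) :
    (scale (fun _ => c) p).IsSymmetric := by
  intro e
  rw [rename_scale, hp e]
  rfl

theorem isSymmetric_of_mul_left {p r : MvPolynomial σ F} (hp0 : p ≠ 0) (hp : p.IsSymmetric)
    (h : (p * r).IsSymmetric) : r.IsSymmetric := by
  intro e
  have := h e
  rw [map_mul, hp e] at this
  exact mul_left_cancel₀ hp0 this

theorem isSymmetric_prod_X_sub_C [Fintype σ] (a : F) :
    (∏ i, (X i - C a) : MvPolynomial σ F).IsSymmetric := by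
  intro e
  simp only [map_prod, map_sub, rename_X, rename_C]
  exact Equiv.prod_comp e fun i => (X i - C a : MvPolynomial σ F)

theorem prod_X_sub_C_dvd [Fintype σ] (a : F) (p : MvPolynomial σ F)
    (h : ∀ i, (X i - C a) ∣ p) : (∏ i, (X i - C a)) ∣ p := by
  classical
  refine Fintype.prod_dvd_of_isRelPrime (fun i j hij => ?_) h
  refine isRelPrime_of_eval (totalDegree_X_sub_C i a) (Function.update (fun _ => a + 1) i a) ?_ ?_
  · simp
  · simp [Function.update_of_ne hij.symm]

theorem totalDegree_prod_of_one {ι : Type*} (s : Finset ι) (f : ι → MvPolynomial σ F)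
    (hf : ∀ i ∈ s, (f i).totalDegree = 1) : (∏ i ∈ s, f i).totalDegree = s.card := by
  classical
  have hne : ∀ i ∈ s, f i ≠ 0 := fun i hi h => by
    have := hf i hi
    simp [h] at this
  induction s using Finset.induction_on with
  | empty => simp
  | insert a s ha ih =>
    rw [Finset.prod_insert ha, totalDegree_mul_of_isDomain (hne _ (Finset.mem_insert_self _ _))
      (Finset.prod_ne_zero_iff.2 fun i hi => hne i (Finset.mem_insert_of_mem hi)),
      ih (fun i hi => hf i (Finset.mem_insert_of_mem hi))
        (fun i hi => hne i (Finset.mem_insert_of_mem hi)),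
      hf _ (Finset.mem_insert_self _ _), Finset.card_insert_of_notMem ha, add_comm]

end Substitution

/-! ### Symmetric polynomials are determined by their values at the nodes -/

section Nodes

variable {F : Type*} [Field F] {q : Fˣ} {t : F}

/-- The parameters `q` and `t` are multiplicatively independent (as far as the nodes see it). -/
structure Generic (q : Fˣ) (t : F) : Prop where
  ne_zero : t ≠ 0
  eq_zero : ∀ a b : ℕ, (q : F) ^ a * t ^ b = 1 → a = 0 ∧ b = 0

/-- The opposite orders of the exponents make the quotient of the two sides a monomial with
exponents in `ℕ`, as `Generic` requires. -/
theorem Generic.node_eq (h : Generic q t) {a b c d : ℕ} (hab : a ≤ c) (hd : d ≤ b)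
    (he : ((q : F) ^ a)⁻¹ * t ^ b = ((q : F) ^ c)⁻¹ * t ^ d) : a = c ∧ b = d := by
  obtain ⟨e, rfl⟩ := Nat.exists_eq_add_of_le hab
  obtain ⟨g, rfl⟩ := Nat.exists_eq_add_of_le hd
  have hq := q.ne_zero
  have ht := h.ne_zero
  have : (q : F) ^ e * t ^ g = 1 := by
    have h1 : (q : F) ^ a ≠ 0 := pow_ne_zero _ hq
    have h2 : t ^ d ≠ 0 := pow_ne_zero _ ht
    have h3 : (q : F) ^ e ≠ 0 := pow_ne_zero _ hq
    rw [pow_add, pow_add] at he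
    field_simp at he
    linear_combination he
  have := h.eq_zero _ _ this
  omega

theorem node_snoc_zero {n : ℕ} (ν : Fin n → ℕ) :
    node q t (Fin.snoc ν 0 : Fin (n + 1) → ℕ) = Fin.snoc (node q t ν) (t ^ n) := by
  ext i
  refine Fin.lastCases ?_ (fun j => ?_) i <;> simp [node]

theorem antitone_snoc_zero {n : ℕ} {ν : Fin n → ℕ} (h : Antitone ν) :
    Antitone (Fin.snoc ν 0 : Fin (n + 1) → ℕ) := by
  intro i j hij
  induction j using Fin.lastCases with
  | last => simp
  | cast j =>
    induction i using Fin.lastCases with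
    | last => exact absurd hij (by simp [Fin.le_def])
    | cast i => simpa using h (by simpa using hij)

/-- A permutation of `Fin n` extended to `Fin (n + 1)` by fixing the last element. -/
theorem exists_perm_snoc {n : ℕ} (e : Equiv.Perm (Fin n)) :
    ∃ e' : Equiv.Perm (Fin (n + 1)), e' (Fin.last n) = Fin.last n ∧
      ∀ i, e' (Fin.castSucc i) = Fin.castSucc (e i) :=
  ⟨finSuccEquivLast.symm.permCongr (Equiv.optionCongr e), by
    simp [Equiv.permCongr_apply], fun i => by simp [Equiv.permCongr_apply]⟩

/-- Specialization of the last variable to the constant `a`. -/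
def specLast (n : ℕ) (a : F) : MvPolynomial (Fin (n + 1)) F →ₐ[F] MvPolynomial (Fin n) F :=
  aeval (Fin.snoc X (C a) : Fin (n + 1) → MvPolynomial (Fin n) F)

theorem isSymmetric_specLast {n : ℕ} (a : F) {f : MvPolynomial (Fin (n + 1)) F}
    (hf : f.IsSymmetric) : (specLast n a f).IsSymmetric := by
  intro e
  obtain ⟨e', h1, h2⟩ := exists_perm_snoc e
  conv_rhs => rw [← hf e']
  rw [← AlgHom.comp_apply, ← AlgHom.comp_apply]
  congr 1
  apply MvPolynomial.algHom_ext
  intro i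
  induction i using Fin.lastCases with
  | last => simp [specLast, h1]
  | cast i => simp [specLast, h2]

theorem totalDegree_specLast_le {n : ℕ} (a : F) (f : MvPolynomial (Fin (n + 1)) F) :
    (specLast n a f).totalDegree ≤ f.totalDegree := by
  refine totalDegree_aeval_le _ (fun k => ?_) f
  induction k using Fin.lastCases <;> simp

theorem eval_specLast {n : ℕ} (a : F) (x : Fin n → F) (f : MvPolynomial (Fin (n + 1)) F) :
    eval x (specLast n a f) = eval (Fin.snoc x a : Fin (n + 1) → F) f := by
  have : (aeval x).comp (specLast n a) = aeval (R := F) (Fin.snoc x a : Fin (n + 1) → F) := by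
    apply MvPolynomial.algHom_ext
    intro i
    induction i using Fin.lastCases <;> simp [specLast]
  simpa [aeval_eq_eval] using DFunLike.congr_fun this f

/-- The factor theorem treats the last variable; symmetry carries the divisor to the others. -/
theorem dvd_of_specLast_eq_zero {n : ℕ} (a : F) {f : MvPolynomial (Fin (n + 1)) F}
    (hf : f.IsSymmetric) (h : specLast n a f = 0) : (∏ i, (X i - C a)) ∣ f := by
  have hlast : (X (Fin.last n) - C a) ∣ f := by
    have := dvd_sub_algHom ((rename Fin.castSucc).comp (specLast n a)) (X (Fin.last n) - C a)
      (fun k => by induction k using Fin.lastCases <;> simp [specLast]) f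
    simpa [h] using this
  refine prod_X_sub_C_dvd a f fun i => ?_
  have := map_dvd (rename (R := F) (Equiv.swap i (Fin.last n))) hlast
  simpa [hf (Equiv.swap i (Fin.last n))] using this

/-- Double induction on `N` and `d`. Partitions with last part zero are partitions with fewer parts,
so `f` vanishes at `x_N = t ^ (N - 1)` and `∏ (x_i - t ^ (N - 1))` divides it. Partitions with all
parts positive are governed by the quotient, of smaller degree. -/
theorem eq_zero_of_eval_node (h : Generic q t) (N : ℕ) : ∀ (d : ℕ) (f : MvPolynomial (Fin N) F),
    f.IsSymmetric → f.totalDegree ≤ d →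
    (∀ ν : Fin N → ℕ, Antitone ν → ∑ i, ν i ≤ d → eval (node q t ν) f = 0) → f = 0 := by
  induction N with
  | zero =>
    intro d f _ _ hv
    have := hv 0 (fun i => i.elim0) (by simp)
    rw [eq_C_of_isEmpty f] at this ⊢
    rw [eval_C] at this
    rw [this, C_0]
  | succ n ihn =>
    intro d
    induction d using Nat.strong_induction_on with
    | _ d ihd =>
    intro f hf hd hv
    have hspec : specLast n (t ^ n) f = 0 := by
      refine ihn d _ (isSymmetric_specLast _ hf) ((totalDegree_specLast_le _ _).trans hd) ?_
      intro ν hν hs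
      rw [eval_specLast, ← node_snoc_zero]
      exact hv _ (antitone_snoc_zero hν) (by simpa [Fin.sum_univ_castSucc] using hs)
    obtain ⟨g, rfl⟩ := dvd_of_specLast_eq_zero _ hf hspec
    by_contra hne
    have hg0 : g ≠ 0 := right_ne_zero_of_mul hne
    have hp0 := left_ne_zero_of_mul hne
    rw [totalDegree_mul_of_isDomain hp0 hg0,
      totalDegree_prod_of_one _ _ fun i _ => totalDegree_X_sub_C i _] at hd
    simp only [Finset.card_univ, Fintype.card_fin] at hd
    have hg : g.IsSymmetric := isSymmetric_of_mul_left hp0 (isSymmetric_prod_X_sub_C _) hf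
    -- Adding `1` to every part multiplies the node by `q⁻¹`, so the rescaled quotient has to vanish
    -- at the nodes of `ν`.
    have key : scale (fun _ => ((q⁻¹ : Fˣ) : F)) g = 0 := by
      refine ihd (d - (n + 1)) (by omega) _ (isSymmetric_scale_const _ hg)
        ((totalDegree_scale_le _ _).trans (by omega)) fun ν hν hs => ?_
      have := hv (fun i => ν i + 1) (fun i j hij => by simpa using hν hij)
        (by simp [Finset.sum_add_distrib]; omega)
      rw [map_mul, map_prod, mul_eq_zero, Finset.prod_eq_zero_iff] at this
      rcases this with ⟨i, _, hi⟩ | this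
      · rw [map_sub, eval_X, eval_C, sub_eq_zero] at hi
        have := h.node_eq (a := 0) (b := n) (c := ν i + 1) (d := i) (by omega) (by omega)
          (by simpa [node] using hi.symm)
        omega
      · rw [eval_scale]
        convert this using 3
        funext i
        simp only [node, Units.val_inv_eq_inv_val, pow_succ, mul_inv]
        ring
    apply hg0
    have := congrArg (scale (fun _ => (q : F))) key
    rw [scale_scale, map_zero] at this
    rw [← scale_one g, ← this]
    congr 2
    ext i
    simp

/-! ### Existence and uniqueness of the interpolation polynomials -/

theorem finite_partitions (N d : ℕ) (P : (Fin N → ℕ) → Prop) (hP : ∀ μ, P μ → ∑ i, μ i ≤ d) :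
    Finite {μ : Fin N → ℕ // P μ} := by
  have key : ∀ (μ : {μ : Fin N → ℕ // P μ}) i, μ.1 i < d + 1 := fun μ i =>
    Nat.lt_succ_of_le ((Finset.single_le_sum (fun _ _ => Nat.zero_le _)
      (Finset.mem_univ i)).trans (hP _ μ.2))
  refine Finite.of_injective (β := Fin N → Fin (d + 1)) (fun μ i => ⟨μ.1 i, key μ i⟩) ?_
  intro μ ν he
  ext i
  simpa using congrFun he i

/-- The sum of all permutations of the monomial `x ^ μ`. -/
def symMonomial (F : Type*) [Field F] {N : ℕ} (μ : Fin N → ℕ) : MvPolynomial (Fin N) F :=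
  ∑ e : Equiv.Perm (Fin N), rename e (monomial (Finsupp.equivFunOnFinite.symm μ) 1)

theorem isSymmetric_symMonomial {N : ℕ} (μ : Fin N → ℕ) : (symMonomial F μ).IsSymmetric := by
  intro e
  simp only [symMonomial, map_sum, rename_rename]
  exact Fintype.sum_equiv (Equiv.mulLeft e) _ _ fun σ => rfl

theorem totalDegree_symMonomial_le {N : ℕ} (μ : Fin N → ℕ) :
    (symMonomial F μ).totalDegree ≤ ∑ i, μ i := by
  refine totalDegree_finsetSum_le fun e _ => (totalDegree_rename_le _ _).trans ?_
  refine (totalDegree_monomial_le _ _).trans ?_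
  rw [Finsupp.sum_fintype] <;> simp

theorem coeff_symMonomial {N : ℕ} (μ ν : Fin N → ℕ) :
    coeff (Finsupp.equivFunOnFinite.symm ν) (symMonomial F μ) =
      ((Finset.univ.filter fun e : Equiv.Perm (Fin N) => μ ∘ e.symm = ν).card : F) := by
  classical
  rw [symMonomial, coeff_sum, Finset.card_filter, Nat.cast_sum]
  refine Finset.sum_congr rfl fun e _ => ?_
  rw [rename_monomial, coeff_monomial, Nat.cast_ite, Nat.cast_one, Nat.cast_zero]
  congr 1
  rw [eq_iff_iff, DFunLike.ext_iff, funext_iff]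
  refine forall_congr' fun i => ?_
  rw [Finsupp.mapDomain_equiv_apply]
  rfl

/-- Two weakly decreasing rearrangements of the same function coincide. -/
theorem coeff_symMonomial_of_ne {N : ℕ} {μ ν : Fin N → ℕ} (hμ : Antitone μ) (hν : Antitone ν)
    (hne : μ ≠ ν) : coeff (Finsupp.equivFunOnFinite.symm ν) (symMonomial F μ) = 0 := by
  rw [coeff_symMonomial, Finset.card_eq_zero.2, Nat.cast_zero]
  rw [Finset.filter_eq_empty_iff]
  intro e _ he
  refine hne ?_
  have := Tuple.unique_antitone (f := μ) (σ := e.symm) (τ := 1) (he ▸ hν) hμ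
  rw [← he, this]
  rfl

/-- The coefficient is the order of the stabilizer of `μ`, nonzero in characteristic zero. -/
theorem coeff_symMonomial_self_ne_zero [CharZero F] {N : ℕ} (μ : Fin N → ℕ) :
    coeff (Finsupp.equivFunOnFinite.symm μ) (symMonomial F μ) ≠ 0 := by
  rw [coeff_symMonomial, Nat.cast_ne_zero, Finset.card_ne_zero]
  exact ⟨1, by simp; rfl⟩

/-- Symmetrized monomials and nodes are indexed by the same finite set, so the evaluation map is a
square system; it is injective by `eq_zero_of_eval_node`, hence surjective. -/
theorem exists_symmetric_eval_node [CharZero F] (h : Generic q t) {N : ℕ} (d : ℕ)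
    (φ : (Fin N → ℕ) → F) :
    ∃ f : MvPolynomial (Fin N) F, f.IsSymmetric ∧ f.totalDegree ≤ d ∧
      ∀ ν : Fin N → ℕ, Antitone ν → ∑ i, ν i ≤ d → eval (node q t ν) f = φ ν := by
  classical
  let S := {μ : Fin N → ℕ // Antitone μ ∧ ∑ i, μ i ≤ d}
  have : Finite S := finite_partitions N d _ fun μ hμ => hμ.2
  have : Fintype S := Fintype.ofFinite S
  let A : (S → F) →ₗ[F] MvPolynomial (Fin N) F :=
    Fintype.linearCombination F fun μ : S => symMonomial F μ.1
  let B : MvPolynomial (Fin N) F →ₗ[F] (S → F) :=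
    LinearMap.pi fun ν : S => (aeval (node q t ν.1)).toLinearMap
  have hAs : ∀ c, (A c).IsSymmetric := fun c => by
    simp only [A, Fintype.linearCombination_apply]
    exact (symmetricSubalgebra (Fin N) F).sum_mem fun μ _ =>
      (symmetricSubalgebra (Fin N) F).smul_mem (isSymmetric_symMonomial μ.1) _
  have hAd : ∀ c, (A c).totalDegree ≤ d := fun c => by
    simp only [A, Fintype.linearCombination_apply]
    exact totalDegree_finsetSum_le fun μ _ => (totalDegree_smul_le _ _).trans
      ((totalDegree_symMonomial_le _).trans μ.2.2)
  have hB : ∀ p ν, B p ν = eval (node q t ν.1) p := fun p ν => by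
    simp [B, aeval_eq_eval]
  have hinj : Function.Injective (B.comp A) := by
    rw [← LinearMap.ker_eq_bot, LinearMap.ker_eq_bot']
    intro c hc
    have hA0 : A c = 0 := eq_zero_of_eval_node h N d _ (hAs c) (hAd c) fun ν hν hs => by
      rw [← hB _ ⟨ν, hν, hs⟩]
      exact congrFun hc _
    funext ν
    have := congrArg (coeff (Finsupp.equivFunOnFinite.symm ν.1)) hA0
    simp only [A, Fintype.linearCombination_apply, coeff_sum, coeff_smul, coeff_zero] at this
    rw [Finset.sum_eq_single ν (fun μ _ hμ => by
      rw [coeff_symMonomial_of_ne μ.2.1 ν.2.1 (fun he => hμ (Subtype.ext he)), smul_zero])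
      (fun hn => absurd (Finset.mem_univ _) hn), smul_eq_mul, mul_eq_zero] at this
    exact this.resolve_right (coeff_symMonomial_self_ne_zero _)
  obtain ⟨c, hc⟩ := LinearMap.injective_iff_surjective.1 hinj fun ν => φ ν.1
  exact ⟨A c, hAs c, hAd c, fun ν hν hs => by
    rw [← hB _ ⟨ν, hν, hs⟩]
    exact congrFun hc _⟩

theorem exists_isInterpolation [CharZero F] (h : Generic q t) {N : ℕ} {μ : Fin N → ℕ}
    (hμ : Antitone μ) : ∃ f, IsInterpolation q t μ f := by
  classical
  obtain ⟨f, hs, hd, hv⟩ := exists_symmetric_eval_node h (∑ i, μ i)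
    (fun ν : Fin N → ℕ => if ν = μ then 1 else 0)
  have hμ1 : eval (node q t μ) f = 1 := by rw [hv μ hμ le_rfl, if_pos rfl]
  refine ⟨f, hs, ?_, fun ν hν hne hle => by rw [hv ν hν hle, if_neg hne], by simp [hμ1]⟩
  by_contra hne
  have hlt : f.totalDegree < ∑ i, μ i := lt_of_le_of_ne hd hne
  -- If the degree dropped, the nodes of size below `|μ|`, where `f` vanishes, would already force
  -- `f = 0`. The subtraction is not truncated, by `hlt`.
  have : f = 0 := eq_zero_of_eval_node h N (∑ i, μ i - 1) f hs (by omega) fun ν hν hle => by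
    rw [hv ν hν (by omega), if_neg]
    rintro rfl
    omega
  simp [this] at hμ1

theorem IsInterpolation.eq_smul (h : Generic q t) {N : ℕ} {μ : Fin N → ℕ} {f g :
    MvPolynomial (Fin N) F} (hf : IsInterpolation q t μ f) (hs : g.IsSymmetric)
    (hd : g.totalDegree ≤ ∑ i, μ i) (c : F)
    (hv : ∀ ν : Fin N → ℕ, Antitone ν → ∑ i, ν i ≤ ∑ i, μ i →
      eval (node q t ν) g = c * eval (node q t ν) f) : g = c • f := by
  rw [← sub_eq_zero]
  refine eq_zero_of_eval_node h N (∑ i, μ i) _ (hs.sub (hf.symm.smul c)) ?_ fun ν hν hle => ?_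
  · exact (totalDegree_sub _ _).trans
      (max_le hd ((totalDegree_smul_le _ _).trans hf.degree.le))
  · rw [map_sub, smul_eval, hv ν hν hle, sub_self]

theorem IsInterpolation.unique (h : Generic q t) {N : ℕ} {μ : Fin N → ℕ}
    {f g : MvPolynomial (Fin N) F} (hf : IsInterpolation q t μ f)
    (hg : IsInterpolation q t μ g) : ∃ c : F, c ≠ 0 ∧ g = c • f := by
  refine ⟨eval (node q t μ) g / eval (node q t μ) f, div_ne_zero hg.nonvanish hf.nonvanish,
    hf.eq_smul h hg.symm hg.degree.le _ fun ν hν hle => ?_⟩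
  by_cases hne : ν = μ
  · subst hne
    rw [div_mul_cancel₀ _ hf.nonvanish]
  · rw [hf.vanish ν hν hne hle, hg.vanish ν hν hne hle, mul_zero]

/-- The interpolation polynomials span the space of symmetric polynomials. -/
theorem mem_span_isInterpolation [CharZero F] (h : Generic q t) {N : ℕ}
    {f : MvPolynomial (Fin N) F} (hf : f.IsSymmetric) :
    f ∈ Submodule.span F {g | ∃ μ : Fin N → ℕ, Antitone μ ∧ IsInterpolation q t μ g} := by
  -- Here `f` vanishes at the nodes of size below `d + 1 - k`. Each step subtracts multiples of the
  -- interpolation polynomials of size `d - k` to kill one more layer; for `k = d + 1` nothing is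
  -- assumed.
  suffices H : ∀ (k d : ℕ) (f : MvPolynomial (Fin N) F), f.IsSymmetric → f.totalDegree ≤ d →
      (∀ ν : Fin N → ℕ, Antitone ν → ∑ i, ν i + k < d + 1 → eval (node q t ν) f = 0) →
      f ∈ Submodule.span F {g | ∃ μ : Fin N → ℕ, Antitone μ ∧ IsInterpolation q t μ g} from
    H (f.totalDegree + 1) f.totalDegree f hf le_rfl fun ν _ hlt => by omega
  intro k d
  induction k with
  | zero =>
    intro f hf hd hv
    rw [eq_zero_of_eval_node h N d f hf hd fun ν hν hle => hv ν hν (by omega)]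
    exact Submodule.zero_mem _
  | succ k ih =>
    intro f hf hd hv
    rcases lt_or_ge d k with hk | hk
    · exact ih f hf hd fun ν hν hlt => by omega
    let S := {μ : Fin N → ℕ // Antitone μ ∧ ∑ i, μ i = d - k}
    have : Finite S := finite_partitions N (d - k) _ fun μ hμ => hμ.2.le
    have : Fintype S := Fintype.ofFinite S
    choose I hI using fun μ : S => exists_isInterpolation h μ.2.1
    let c : S → F := fun μ => eval (node q t μ.1) f / eval (node q t μ.1) (I μ)
    have hsub := ih (f - ∑ μ, c μ • I μ)
      (hf.sub ((symmetricSubalgebra (Fin N) F).sum_mem fun μ _ =>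
        (symmetricSubalgebra (Fin N) F).smul_mem (hI μ).symm _))
      ((totalDegree_sub _ _).trans (max_le hd (totalDegree_finsetSum_le fun μ _ =>
        (totalDegree_smul_le _ _).trans ((hI μ).degree.le.trans (by have := μ.2.2; omega)))))
      (fun ν hν hlt => by
        rw [map_sub, map_sum, sub_eq_zero]
        simp only [smul_eval]
        by_cases hs : ∑ i, ν i = d - k
        · rw [Finset.sum_eq_single (⟨ν, hν, hs⟩ : S)]
          · exact (div_mul_cancel₀ _ (hI ⟨ν, hν, hs⟩).nonvanish).symm
          · intro μ _ hμ
            rw [(hI μ).vanish ν hν (fun he => hμ (Subtype.ext he.symm))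
              (by rw [μ.2.2, hs]), mul_zero]
          · exact fun hn => absurd (Finset.mem_univ _) hn
        · rw [hv ν hν (by omega), Finset.sum_eq_zero]
          intro μ _
          rw [(hI μ).vanish ν hν (fun he => hs (by rw [he]; exact μ.2.2))
            (by have := μ.2.2; omega), mul_zero])
    have hsum : ∑ μ, c μ • I μ ∈
        Submodule.span F {g | ∃ μ : Fin N → ℕ, Antitone μ ∧ IsInterpolation q t μ g} :=
      Submodule.sum_mem _ fun μ _ => Submodule.smul_mem _ _
        (Submodule.subset_span ⟨μ.1, μ.2.1, hI μ⟩)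
    simpa using Submodule.add_mem _ hsub hsum

end Nodes

/-! ### The difference product -/

/-- The difference product `∏_{i < j} (y_i - y_j)`. -/
def diffProd {R : Type*} [CommRing R] {N : ℕ} (y : Fin N → R) : R :=
  ∏ i, ∏ j ∈ Finset.Ioi i, (y i - y j)

section DiffProd

variable {R S : Type*} [CommRing R] [CommRing S] {N : ℕ}

theorem diffProd_comp_perm (y : Fin N → R) (e : Equiv.Perm (Fin N)) :
    diffProd (y ∘ e) = ((Equiv.Perm.sign e : ℤˣ) : R) * diffProd y :=
  e.prod_Ioi_comp_eq_sign_mul_prod (f := fun i j => y i - y j) fun i j => by ring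

theorem map_diffProd {G : Type*} [FunLike G R S] [RingHomClass G R S] (φ : G) (y : Fin N → R) :
    φ (diffProd y) = diffProd fun i => φ (y i) := by
  simp [diffProd, map_prod, map_sub]

theorem diffProd_eq_prod_sigma (y : Fin N → R) :
    diffProd y = ∏ p ∈ Finset.univ.sigma fun i : Fin N => Finset.Ioi i, (y p.1 - y p.2) :=
  Finset.prod_sigma' _ _ _

theorem diffProd_eq_zero_of_eq {y : Fin N → R} {i j : Fin N} (hij : i < j) (h : y i = y j) :
    diffProd y = 0 := by
  rw [diffProd]
  exact Finset.prod_eq_zero (Finset.mem_univ i)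
    (Finset.prod_eq_zero (Finset.mem_Ioi.2 hij) (sub_eq_zero.2 h))

theorem diffProd_ne_zero [IsDomain R] {y : Fin N → R} (h : ∀ i j, i < j → y i ≠ y j) :
    diffProd y ≠ 0 := by
  refine Finset.prod_ne_zero_iff.2 fun i _ => Finset.prod_ne_zero_iff.2 fun j hj => ?_
  exact sub_ne_zero.2 (h i j (Finset.mem_Ioi.1 hj))

end DiffProd

/-! ### The numerator of `D_N(z) f`: divisibility, degree and values at the nodes -/

section Numerator

variable {F : Type*} [Field F] {N : ℕ}

theorem isRelPrime_X_sub_X [CharZero F] {i j k l : Fin N} (hij : i < j) (hkl : k < l)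
    (h : ¬ (i = k ∧ j = l)) :
    IsRelPrime (X i - X j : MvPolynomial (Fin N) F) (X k - X l) := by
  refine isRelPrime_of_eval (totalDegree_X_sub_X hij.ne)
    -- Coordinates `i` and `j` are zero, the others distinct and nonzero, so no other difference
    -- vanishes.
    (fun m => if m = i ∨ m = j then 0 else ((m : ℕ) + 1 : ℕ)) ?_ ?_
  · simp
  · simp only [map_sub, eval_X, sub_ne_zero]
    rw [← Nat.cast_zero, ← Nat.cast_ite, ← Nat.cast_ite, Nat.cast_injective.ne_iff]
    split_ifs with h1 h2 h2 <;> omega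

theorem diffProd_mul_prod_X_dvd [CharZero F] {p : MvPolynomial (Fin N) F}
    (h1 : ∀ i j, i < j → (X i - X j) ∣ p) (h2 : ∀ i, X i ∣ p) :
    (diffProd X * ∏ i, X i) ∣ p := by
  have hX : ∀ i : Fin N, (X i : MvPolynomial (Fin N) F).totalDegree = 1 := fun i => totalDegree_X i
  refine IsRelPrime.mul_dvd ?_ ?_ ?_
  · rw [diffProd_eq_prod_sigma]
    refine IsRelPrime.prod_left fun a ha => IsRelPrime.prod_right fun k _ => ?_
    simp only [Finset.mem_sigma, Finset.mem_univ, Finset.mem_Ioi, true_and] at ha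
    exact isRelPrime_of_eval (totalDegree_X_sub_X ha.ne) 1 (by simp) (by simp)
  · rw [diffProd_eq_prod_sigma]
    refine Finset.prod_dvd_of_isRelPrime ?_ ?_
    · rintro ⟨i, j⟩ hij ⟨k, l⟩ hkl hne
      simp only [Finset.coe_sigma, Finset.coe_univ, Set.mem_sigma_iff, Set.mem_univ, true_and,
        Finset.coe_Ioi, Set.mem_Ioi] at hij hkl
      refine isRelPrime_X_sub_X hij hkl ?_
      rintro ⟨rfl, rfl⟩
      exact hne rfl
    · rintro ⟨i, j⟩ hij
      exact h1 i j (by simpa using hij)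
  · refine Fintype.prod_dvd_of_isRelPrime (fun i j hij => ?_) h2
    exact isRelPrime_of_eval (hX i) (Function.update 1 i 0) (by simp)
      (by simp [Function.update_of_ne hij.symm])

/-- Setting `x_i = x_j` absorbs the transposition, so the specialization of `p` equals its own
negative. -/
theorem X_sub_X_dvd_of_rename_swap [CharZero F] {p : MvPolynomial (Fin N) F} {i j : Fin N}
    (h : rename (Equiv.swap i j) p = -p) : (X i - X j) ∣ p := by
  let φ : MvPolynomial (Fin N) F →ₐ[F] MvPolynomial (Fin N) F :=
    aeval fun k => if k = i then X j else X k
  have hφ : φ.comp (rename (Equiv.swap i j)) = φ := by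
    apply MvPolynomial.algHom_ext
    intro k
    simp only [φ, AlgHom.comp_apply, rename_X, aeval_X, Equiv.swap_apply_def]
    split_ifs <;> simp_all
  have h0 : φ p = 0 := by
    have := DFunLike.congr_fun hφ p
    rw [AlgHom.comp_apply, h, map_neg] at this
    exact self_eq_neg.1 this.symm
  have := dvd_sub_algHom φ (X i - X j) (fun k => by
    simp only [φ, aeval_X]
    split_ifs with hk <;> simp [hk]) p
  simpa [h0] using this

/-- The entries of the operator matrix are sums of two terms, with and without `q`-shift; this is
the scalar factor of the term of a column, multiplied by the variable of the column. -/
def colFactor (t z : F) (β : Fin N → Bool) (j : Fin N) : MvPolynomial (Fin N) F :=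
  if β j then C z * (C (t ^ (1 - (N : ℤ))) * X j - 1) else X j + C z

/-- The variables, multiplied by `c` where `β` is true. -/
def scaledVar (c : F) (β : Fin N → Bool) (j : Fin N) : MvPolynomial (Fin N) F :=
  if β j then C c * X j else X j

/-- The function which is `c` where `β` is true, and `1` elsewhere. -/
def indPow {M : Type*} [One M] (c : M) (β : Fin N → Bool) (j : Fin N) : M := if β j then c else 1

/-- The polynomial `V · x₁ ⋯ x_N · D_N(z) f`. -/
def numerator (q t z : F) (f : MvPolynomial (Fin N) F) : MvPolynomial (Fin N) F :=
  ∑ β : Fin N → Bool, (∏ j, colFactor t z β j) * diffProd (scaledVar t β) * scale (indPow q β) f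

/-- The permutation only relabels the choices `β`; the sign comes from the difference product. -/
theorem rename_numerator (q t z : F) {f : MvPolynomial (Fin N) F} (hf : f.IsSymmetric)
    (e : Equiv.Perm (Fin N)) :
    rename e (numerator q t z f) =
      ((Equiv.Perm.sign e : ℤˣ) : MvPolynomial (Fin N) F) * numerator q t z f := by
  rw [numerator, map_sum, Finset.mul_sum]
  refine Fintype.sum_equiv (Equiv.arrowCongr e (Equiv.refl Bool)) _ _ fun β => ?_
  set γ := Equiv.arrowCongr e (Equiv.refl Bool) β with hγ
  have hβ : ∀ j, β j = γ (e j) := fun j => by simp [hγ]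
  have h1 : ∀ j, rename e (colFactor t z β j) = colFactor t z γ (e j) := fun j => by
    rw [colFactor, colFactor, ← hβ]
    split_ifs <;> simp
  have h2 : ∀ j, rename e (scaledVar t β j) = scaledVar t γ (e j) := fun j => by
    rw [scaledVar, scaledVar, ← hβ]
    split_ifs <;> simp
  have h3 : indPow q β ∘ e.symm = indPow q γ := by
    ext j
    simp [indPow, hβ]
  rw [map_mul, map_mul, map_prod, map_diffProd, rename_scale, hf e, h3]
  simp only [h1, h2]
  have h4 := diffProd_comp_perm (scaledVar t γ) e
  simp only [Function.comp_def] at h4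
  rw [h4, Equiv.prod_comp e (colFactor t z γ)]
  ring

/-- At `x_j = 0` the terms of `β` and of `β` flipped at `j` cancel: the factors of column `j` become
`-z` and `z`, and scaling `x_j` has no effect elsewhere. -/
theorem X_dvd_numerator (q t z : F) (f : MvPolynomial (Fin N) F) (j : Fin N) :
    X j ∣ numerator q t z f := by
  let φ : MvPolynomial (Fin N) F →ₐ[F] MvPolynomial (Fin N) F := scale (Function.update 1 j 0)
  suffices h0 : φ (numerator q t z f) = 0 by
    have := dvd_sub_algHom φ (X j) (fun k => by
      by_cases hk : k = j
      · subst hk; simp [φ]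
      · simp [φ, Function.update_of_ne hk]) (numerator q t z f)
    simpa [h0] using this
  rw [numerator, map_sum]
  refine Finset.sum_involution (fun β _ => Function.update β j (!β j)) ?_ ?_
    (fun _ _ => Finset.mem_univ _) (fun β _ => by simp)
  · intro β _
    set γ := Function.update β j (!β j) with hγ
    have hj : γ j = !β j := by simp [hγ]
    have hk : ∀ k, k ≠ j → γ k = β k := fun k hk => by simp [hγ, hk]
    have h1 : φ (∏ k, colFactor t z β k) = -φ (∏ k, colFactor t z γ k) := by
      rw [← Finset.mul_prod_erase _ _ (Finset.mem_univ j),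
        ← Finset.mul_prod_erase _ (colFactor t z γ) (Finset.mem_univ j),
        Finset.prod_congr rfl (g := colFactor t z γ), map_mul, map_mul, ← neg_mul]
      · congr 1
        rw [colFactor, colFactor, hj]
        have hX : φ (X j) = 0 := by simp [φ]
        have hC : ∀ a, φ (C a) = C a := fun a => by rw [← algebraMap_eq, AlgHom.commutes]
        cases β j <;> simp [hX, hC]
      · intro k hk'
        rw [colFactor, colFactor, hk k (Finset.ne_of_mem_erase hk')]
    have h2 : φ (diffProd (scaledVar t β)) = φ (diffProd (scaledVar t γ)) := by
      rw [map_diffProd, map_diffProd]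
      congr 1
      ext1 k
      by_cases hkj : k = j
      · subst hkj
        rw [scaledVar, scaledVar]
        split_ifs <;> simp [φ]
      · rw [scaledVar, scaledVar, hk k hkj]
    have h3 : φ (scale (indPow q β) f) = φ (scale (indPow q γ) f) := by
      rw [scale_scale, scale_scale]
      congr 2
      ext k
      by_cases hkj : k = j
      · subst hkj; simp
      · simp [indPow, hk k hkj]
    rw [map_mul, map_mul, map_mul, map_mul, h1, h2, h3]
    ring
  · intro β _ _ he
    have := congrFun he j
    simp at this

theorem diffProd_X_ne_zero : diffProd (X : Fin N → MvPolynomial (Fin N) F) ≠ 0 :=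
  diffProd_ne_zero fun _ _ hij h => hij.ne (X_injective h)

theorem prod_X_ne_zero : (∏ i : Fin N, (X i : MvPolynomial (Fin N) F)) ≠ 0 :=
  Finset.prod_ne_zero_iff.2 fun i _ => X_ne_zero i

theorem totalDegree_numerator_le (q t z : F) (f : MvPolynomial (Fin N) F) :
    (numerator q t z f).totalDegree ≤
      (diffProd (X : Fin N → MvPolynomial (Fin N) F) * ∏ i, X i).totalDegree + f.totalDegree := by
  rw [totalDegree_mul_of_isDomain diffProd_X_ne_zero prod_X_ne_zero, diffProd_eq_prod_sigma,
    totalDegree_prod_of_one _ _ fun a ha => totalDegree_X_sub_X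
      (by simpa using ne_of_lt (by simpa using ha)),
    totalDegree_prod_of_one _ _ fun i _ => totalDegree_X i]
  refine totalDegree_finsetSum_le fun β _ => (totalDegree_mul _ _).trans ?_
  refine add_le_add ((totalDegree_mul _ _).trans ?_) (totalDegree_scale_le _ _)
  rw [add_comm]
  have hs : ∀ j, (scaledVar t β j).totalDegree ≤ 1 := fun j => by
    rw [scaledVar]
    split_ifs
    · exact (totalDegree_mul _ _).trans (by simp)
    · simp
  refine add_le_add ?_ ?_
  · rw [diffProd_eq_prod_sigma]
    refine (totalDegree_finsetProd _ _).trans ?_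
    rw [Finset.card_eq_sum_ones]
    exact Finset.sum_le_sum fun a _ => (totalDegree_sub _ _).trans (max_le (hs _) (hs _))
  · refine (totalDegree_finsetProd _ _).trans ?_
    rw [Finset.card_eq_sum_ones]
    refine Finset.sum_le_sum fun j _ => ?_
    rw [colFactor]
    split_ifs
    · refine (totalDegree_mul _ _).trans ?_
      rw [totalDegree_C, zero_add]
      refine (totalDegree_sub _ _).trans (max_le ((totalDegree_mul _ _).trans ?_) ?_) <;> simp
    · exact (totalDegree_add _ _).trans (by simp)

theorem exists_numerator_eq [CharZero F] (q t z : F) {f : MvPolynomial (Fin N) F}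
    (hf : f.IsSymmetric) : ∃ g : MvPolynomial (Fin N) F,
      numerator q t z f = diffProd X * (∏ i, X i) * g ∧ g.IsSymmetric ∧
        g.totalDegree ≤ f.totalDegree := by
  obtain ⟨g, hg⟩ := diffProd_mul_prod_X_dvd (p := numerator q t z f)
    (fun i j hij => X_sub_X_dvd_of_rename_swap (by
      rw [rename_numerator q t z hf, Equiv.Perm.sign_swap hij.ne]
      simp))
    (X_dvd_numerator q t z f)
  have hne : diffProd (X : Fin N → MvPolynomial (Fin N) F) * ∏ i, X i ≠ 0 :=
    mul_ne_zero diffProd_X_ne_zero prod_X_ne_zero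
  refine ⟨g, hg, fun e => ?_, ?_⟩
  · have := rename_numerator q t z hf e
    rw [hg, map_mul, map_mul, map_diffProd, map_prod] at this
    simp only [rename_X] at this
    have h4 := diffProd_comp_perm (X : Fin N → MvPolynomial (Fin N) F) e
    simp only [Function.comp_def] at h4
    rw [h4, Equiv.prod_comp e (X : Fin N → MvPolynomial (Fin N) F), mul_assoc, mul_assoc] at this
    have hs : ((Equiv.Perm.sign e : ℤˣ) : MvPolynomial (Fin N) F) ≠ 0 := by
      rcases Int.units_eq_one_or (Equiv.Perm.sign e) with h | h <;> simp [h]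
    exact mul_left_cancel₀ hne (by simpa [mul_assoc] using mul_left_cancel₀ hs this)
  · by_cases h0 : g = 0
    · simp [h0]
    · have := totalDegree_numerator_le q t z f
      rw [hg, totalDegree_mul_of_isDomain hne h0] at this
      omega

/-! ### Values of the numerator at the nodes -/

theorem eval_numerator (q t z : F) (f : MvPolynomial (Fin N) F) (x : Fin N → F) :
    eval x (numerator q t z f) = ∑ β : Fin N → Bool,
      (∏ j, if β j then z * (t ^ (1 - (N : ℤ)) * x j - 1) else x j + z) *
        diffProd (fun j => if β j then t * x j else x j) *
        eval (fun j => indPow q β j * x j) f := by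
  simp only [numerator, map_sum, map_mul, map_prod, map_diffProd, eval_scale, colFactor, scaledVar,
    apply_ite (eval x), map_sub, map_add, eval_X, eval_C, map_one]

theorem node_sub_indicator {q : Fˣ} {t : F} {μ ν : Fin N → ℕ} {β : Fin N → Bool}
    (h : ∀ j, μ j = ν j + if β j then 1 else 0) (j : Fin N) :
    indPow (q : F) β j * node q t μ j = node q t ν j := by
  have hq := q.ne_zero
  rw [node, node, indPow, h j]
  split_ifs
  · rw [pow_succ, mul_inv]
    field_simp
  · simp

/-- The hypotheses rule out a negative last part and a descent `μ_i - 1 < μ_{i+1}`. Positivity of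
the shifted parts, needed for subtraction in `ℕ`, propagates upwards from the last row. -/
theorem exists_antitone_sub {n : ℕ} {μ : Fin (n + 1) → ℕ} (hμ : Antitone μ)
    {β : Fin (n + 1) → Bool} (hlast : β (Fin.last n) = true → μ (Fin.last n) ≠ 0)
    (hstep : ∀ i : Fin n, β i.castSucc = true → β i.succ = false → μ i.castSucc ≠ μ i.succ) :
    ∃ ν : Fin (n + 1) → ℕ, Antitone ν ∧ ∀ j, μ j = ν j + if β j then 1 else 0 := by
  have hpos : ∀ j, β j = true → 1 ≤ μ j := by
    intro j
    induction j using Fin.reverseInduction with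
    | last => exact fun h => Nat.one_le_iff_ne_zero.2 (hlast h)
    | cast i ih =>
      intro h
      have := hμ i.castSucc_le_succ
      cases hb : β i.succ
      · have := hstep i h hb
        omega
      · have := ih hb
        omega
  refine ⟨fun j => μ j - if β j then 1 else 0, Fin.antitone_iff_succ_le.2 fun i => ?_, fun j => ?_⟩
  · have h0 := hμ i.castSucc_le_succ
    have h1 := hstep i
    cases hb : β i.succ <;> cases ha : β i.castSucc <;> simp [hb, ha] at h1 ⊢ <;> omega
  · have := hpos j
    cases hb : β j
    · simp [hb]
    · have := this hb
      simp only [hb, if_true]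
      omega

theorem eval_node_numerator {q : Fˣ} {t : F} (h : Generic q t) (z : F)
    (f : MvPolynomial (Fin N) F) {μ : Fin N → ℕ} (hμ : Antitone μ)
    (hv : ∀ ν : Fin N → ℕ, Antitone ν → ∑ i, ν i < ∑ i, μ i → eval (node q t ν) f = 0) :
    eval (node q t μ) (numerator (q : F) t z f) =
      (∏ j, (node q t μ j + z)) * diffProd (node q t μ) * eval (node q t μ) f := by
  rw [eval_numerator, Finset.sum_eq_single (fun _ => false)]
  · simp [indPow]
  · intro β _ hβ
    obtain ⟨k, hk⟩ : ∃ k, β k = true := by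
      by_contra hne
      push Not at hne
      exact hβ (funext fun k => by simpa using hne k)
    obtain ⟨n, rfl⟩ : ∃ n, N = n + 1 := ⟨N - 1, by have := k.2; omega⟩
    have ht := h.ne_zero
    -- A last part that would become negative: the node has `x_N = t ^ (N - 1)`, which kills `t ^ (1
    -- - N) x_N - 1`.
    by_cases h1 : β (Fin.last n) = true ∧ μ (Fin.last n) = 0
    · rw [Finset.prod_eq_zero (Finset.mem_univ (Fin.last n)), zero_mul, zero_mul]
      rw [if_pos h1.1, node, h1.2, Fin.val_last]
      have : t ^ (1 - ((n + 1 : ℕ) : ℤ)) * t ^ n = 1 := by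
        rw [← zpow_natCast, ← zpow_add₀ ht]
        simp
      linear_combination z * this
    -- A failure of monotonicity: equal parts give `t x_i = x_{i+1}`, which kills the difference
    -- product.
    by_cases h2 : ∃ i : Fin n, β i.castSucc = true ∧ β i.succ = false ∧ μ i.castSucc = μ i.succ
    · obtain ⟨i, h2, h3, h4⟩ := h2
      rw [diffProd_eq_zero_of_eq i.castSucc_lt_succ, mul_zero, zero_mul]
      simp only [h2, h3, if_true, node, h4, Fin.val_castSucc, Fin.val_succ, Bool.false_eq_true,
        if_false]
      ring
    obtain ⟨ν, hν, hsub⟩ := exists_antitone_sub hμ (β := β) (fun ha hb => h1 ⟨ha, hb⟩)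
      (fun i ha hb hc => h2 ⟨i, ha, hb, hc⟩)
    simp only [node_sub_indicator hsub]
    rw [hv ν hν, mul_zero]
    refine Finset.sum_lt_sum (fun i _ => by rw [hsub i]; omega) ⟨k, Finset.mem_univ _, ?_⟩
    rw [hsub k, hk]
    simp
  · exact fun hn => absurd (Finset.mem_univ _) hn

theorem node_ne_zero {q : Fˣ} {t : F} (h : Generic q t) (μ : Fin N → ℕ) (j : Fin N) :
    node q t μ j ≠ 0 :=
  mul_ne_zero (inv_ne_zero (pow_ne_zero _ q.ne_zero)) (pow_ne_zero _ h.ne_zero)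

theorem diffProd_node_ne_zero {q : Fˣ} {t : F} (h : Generic q t) {μ : Fin N → ℕ}
    (hμ : Antitone μ) : diffProd (node q t μ) ≠ 0 :=
  diffProd_ne_zero fun i j hij he => by
    have := h.node_eq (hμ hij.le) hij.le he.symm
    omega

/-- Interpolation polynomials are eigenfunctions, in polynomial form. -/
theorem IsInterpolation.numerator_eq [CharZero F] {q : Fˣ} {t : F} (h : Generic q t) (z : F)
    {f : MvPolynomial (Fin N) F} {μ : Fin N → ℕ} (hμ : Antitone μ)
    (hf : IsInterpolation q t μ f) :
    numerator (q : F) t z f = diffProd X * (∏ i, X i) *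
      ((∏ i, (1 + (q : F) ^ μ i * (t ^ (i : ℕ))⁻¹ * z)) • f) := by
  obtain ⟨g, hg, hs, hd⟩ := exists_numerator_eq (q : F) t z hf.symm
  rw [hg]
  congr 1
  refine hf.eq_smul h hs (hd.trans hf.degree.le) _ fun ν hν hle => ?_
  have key := eval_node_numerator h z f hν fun κ hκ hlt =>
    hf.vanish κ hκ (by rintro rfl; omega) (by omega)
  rw [hg, map_mul, map_mul, map_diffProd, map_prod] at key
  simp only [eval_X] at key
  have hne : diffProd (node q t ν) * ∏ i, node q t ν i ≠ 0 :=
    mul_ne_zero (diffProd_node_ne_zero h hν)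
      (Finset.prod_ne_zero_iff.2 fun i _ => node_ne_zero h ν i)
  by_cases hνμ : ν = μ
  · subst hνμ
    refine mul_left_cancel₀ hne (key.trans ?_)
    -- The eigenvalue appears by pulling `x_i` out of `x_i + z`.
    have : ∏ i, (node q t ν i + z) =
        (∏ i, node q t ν i) * ∏ i, (1 + (q : F) ^ ν i * (t ^ (i : ℕ))⁻¹ * z) := by
      rw [← Finset.prod_mul_distrib]
      refine Finset.prod_congr rfl fun i _ => ?_
      have hq := q.ne_zero
      have ht := h.ne_zero
      rw [node]
      field_simp
    rw [this]
    ring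
  · rw [hf.vanish ν hν hνμ hle, mul_zero] at key ⊢
    exact (mul_eq_zero.1 key).resolve_left hne

end Numerator

/-! ### Products of noncommuting operators -/

section NoncommProd

variable {R : Type*} [Ring R]

theorem prod_ofFn_sum {n : ℕ} {ι : Type*} [Fintype ι] (g : Fin n → ι → R) :
    (List.ofFn fun j => ∑ b, g j b).prod =
      ∑ β : Fin n → ι, (List.ofFn fun j => g j (β j)).prod := by
  classical
  have := (MultilinearMap.mkPiAlgebraFin ℤ n R).map_sum (α := fun _ => ι) g
  simpa [MultilinearMap.mkPiAlgebraFin_apply] using this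

/-- Each `s i` only has to pass the later `a j`; it never meets its own `a i`, with which it need
not commute. -/
theorem prod_ofFn_mul {n : ℕ} (a s : Fin n → R) (h : ∀ i j, i ≠ j → Commute (s i) (a j)) :
    (List.ofFn fun j => a j * s j).prod = (List.ofFn a).prod * (List.ofFn s).prod := by
  induction n with
  | zero => simp
  | succ n ih =>
    simp only [List.ofFn_succ, List.prod_cons]
    rw [ih (fun j => a j.succ) (fun j => s j.succ)
      fun i j hij => h _ _ (fun he => hij (Fin.succ_injective _ he))]
    have : Commute (s 0) (List.ofFn fun j : Fin n => a j.succ).prod :=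
      Commute.list_prod_right _ _ fun x hx => by
        obtain ⟨j, rfl⟩ := List.mem_ofFn.1 hx
        exact h _ _ (Fin.succ_ne_zero j).symm
    simp only [mul_assoc]
    rw [← mul_assoc (s 0), this.eq, mul_assoc]

/-- Expansion of a column determinant whose entries are sums of commuting elements times elements
which depend only on the column. -/
theorem columnDet_sum {S ι : Type*} [CommRing S] [Fintype ι] {n : ℕ} (φ : S →+* R)
    (p : Fin n → Fin n → ι → S) (s : Fin n → ι → R)
    (h : ∀ i j, i ≠ j → ∀ k b c, Commute (s i b) (φ (p k j c))) :
    columnDet (fun i j => ∑ b, φ (p i j b) * s j b) =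
      ∑ β : Fin n → ι, φ (∑ σ : Equiv.Perm (Fin n), ((Equiv.Perm.sign σ : ℤˣ) : ℤ) •
        ∏ j, p (σ j) j (β j)) * (List.ofFn fun j => s j (β j)).prod := by
  simp only [columnDet, prod_ofFn_sum, Finset.smul_sum]
  rw [Finset.sum_comm]
  refine Finset.sum_congr rfl fun β _ => ?_
  rw [map_sum, Finset.sum_mul]
  refine Finset.sum_congr rfl fun σ _ => ?_
  rw [prod_ofFn_mul _ _ fun i j hij => h i j hij _ _ _, map_zsmul, smul_mul_assoc,
    ← List.prod_ofFn, map_list_prod, List.map_ofFn]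
  rfl

theorem prod_ofFn_map {M R : Type*} [CommMonoid M] [Monoid R] {n : ℕ} (φ : M →* R)
    (m : Fin n → M) :
    (List.ofFn fun j => φ (m j)).prod = φ (∏ j, m j) := by
  rw [← List.prod_ofFn, map_list_prod, List.map_ofFn]
  rfl

end NoncommProd

theorem det_mul_pow_rev {R : Type*} [CommRing R] {N : ℕ} (u y : Fin N → R) :
    ∑ σ : Equiv.Perm (Fin N), ((Equiv.Perm.sign σ : ℤˣ) : ℤ) •
      ∏ j, (u j * y j ^ (N - ((σ j : ℕ) + 1))) = (∏ j, u j) * diffProd y := by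
  -- The homogeneous Vandermonde matrix with first argument `1` has decreasing exponents and
  -- produces the differences `y i - y j`, `i < j`, without a sign.
  have h1 := Matrix.det_mul_row u (Matrix.projVandermonde (1 : Fin N → R) y).transpose
  rw [Matrix.det_transpose, Matrix.det_projVandermonde, Matrix.det_apply] at h1
  simp only [Pi.one_apply, one_mul] at h1
  rw [diffProd, ← h1]
  refine Finset.sum_congr rfl fun σ _ => ?_
  simp only [Matrix.of_apply, Matrix.transpose_apply, Matrix.projVandermonde_apply, Pi.one_apply,
    one_pow, one_mul, Fin.val_rev, Units.smul_def]

/-! ### Multiplicative shifts of rational functions -/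

section Shift

variable {F : Type*} [Field F] {N : ℕ}

/-- The substitution `x_j ↦ c_j x_j` as an automorphism of the polynomial algebra. -/
def scaleEquiv (c : Fin N → Fˣ) : MvPolynomial (Fin N) F ≃ₐ[F] MvPolynomial (Fin N) F :=
  AlgEquiv.ofAlgHom (scale fun j => (c j : F)) (scale fun j => ((c j)⁻¹ : Fˣ))
    (AlgHom.ext fun p => by
      rw [AlgHom.comp_apply, scale_scale, AlgHom.id_apply]
      convert scale_one p
      ext j
      simp)
    (AlgHom.ext fun p => by
      rw [AlgHom.comp_apply, scale_scale, AlgHom.id_apply]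
      convert scale_one p
      ext j
      simp)

/-- The substitution `x_j ↦ c_j x_j` on rational functions. -/
def shift (c : Fin N → Fˣ) : RatF F N ≃ₐ[F] RatF F N :=
  IsFractionRing.fieldEquivOfAlgEquiv F (RatF F N) (RatF F N) (scaleEquiv c)

/-- The substitution `x_j ↦ c_j x_j` as a linear operator on rational functions. -/
def shiftOp (c : Fin N → Fˣ) : Module.End F (RatF F N) := (shift c).toLinearMap

theorem shift_algebraMap (c : Fin N → Fˣ) (p : MvPolynomial (Fin N) F) :
    shift c (algebraMap _ (RatF F N) p) = algebraMap _ _ (scale (fun j => (c j : F)) p) :=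
  IsFractionRing.fieldEquivOfAlgEquiv_algebraMap F (RatF F N) (RatF F N) (scaleEquiv c) p

theorem shift_mul (c d : Fin N → Fˣ) (k : RatF F N) : shift (c * d) k = shift c (shift d k) := by
  obtain ⟨a, b, -, rfl⟩ := IsFractionRing.div_surjective (A := MvPolynomial (Fin N) F) k
  simp only [map_div₀, shift_algebraMap, scale_scale]
  rfl

theorem shift_one (k : RatF F N) : shift 1 k = k := by
  obtain ⟨a, b, -, rfl⟩ := IsFractionRing.div_surjective (A := MvPolynomial (Fin N) F) k
  have h : ∀ p : MvPolynomial (Fin N) F, scale (fun j => (((1 : Fin N → Fˣ) j : Fˣ) : F)) p = p :=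
    fun p => (congrArg (fun c => scale c p) (funext fun j => by simp)).trans (scale_one p)
  simp only [map_div₀, shift_algebraMap, h]

/-- `shiftOp` as a monoid homomorphism. -/
def shiftMonoidHom (F : Type*) [Field F] (N : ℕ) : (Fin N → Fˣ) →* Module.End F (RatF F N) where
  toFun := shiftOp
  map_one' := LinearMap.ext shift_one
  map_mul' c d := LinearMap.ext (shift_mul c d)

theorem shift_xv (c : Fin N → Fˣ) (j : Fin N) :
    shift c (xv F j) = algebraMap F (RatF F N) (c j) * xv F j := by
  rw [xv, shift_algebraMap, scale_X, map_mul, ← algebraMap_eq, ← IsScalarTower.algebraMap_apply]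

theorem qShift_eq_shiftOp (q : Fˣ) (j : Fin N) :
    qShift q j = shiftOp (Function.update 1 j q) := by
  have : polyShift q j = scaleEquiv (Function.update 1 j q) := by
    ext1 p
    change scaleVar j (q : F) p = scale _ p
    congr 1
    apply MvPolynomial.algHom_ext
    intro i
    by_cases hi : i = j
    · subst hi; simp [scaleVar]
    · simp [scaleVar, hi]
  rw [qShift, this]
  rfl

/-- Multiplication operators as a ring homomorphism. -/
def mulHom (F : Type*) [Field F] (N : ℕ) : RatF F N →+* Module.End F (RatF F N) :=
  (Algebra.lmul F (RatF F N)).toRingHom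

theorem mulOp_eq (g : RatF F N) : mulOp g = mulHom F N g := rfl

theorem shiftOp_mul_mulHom (c : Fin N → Fˣ) (g : RatF F N) :
    shiftOp c * mulHom F N g = mulHom F N (shift c g) * shiftOp c :=
  LinearMap.ext fun k => map_mul (shift c) g k

/-- Multiplication by polynomials in `z` with rational functions as coefficients. -/
def polyMul (F : Type*) [Field F] (N : ℕ) :
    Polynomial (RatF F N) →+* Polynomial (Module.End F (RatF F N)) :=
  Polynomial.mapRingHom (mulHom F N)

theorem coeff_polyMul_mul_C (p : Polynomial (RatF F N)) (a : Module.End F (RatF F N)) (n : ℕ) :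
    (polyMul F N p * Polynomial.C a).coeff n = mulHom F N (p.coeff n) * a := by
  rw [Polynomial.coeff_mul_C, polyMul, Polynomial.coe_mapRingHom, Polynomial.coeff_map]

theorem commute_shiftOp_polyMul {c : Fin N → Fˣ} {p : Polynomial (RatF F N)}
    (h : p.map (shift c : RatF F N →+* RatF F N) = p) :
    Commute (Polynomial.C (shiftOp c)) (polyMul F N p) := by
  ext1
  rw [coeff_polyMul_mul_C, Polynomial.coeff_C_mul, polyMul, Polynomial.coe_mapRingHom,
    Polynomial.coeff_map, shiftOp_mul_mulHom]
  congr 2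
  conv_rhs => rw [← h]
  rw [Polynomial.coeff_map]
  rfl

theorem coeff_applyOp (P : Polynomial (Module.End F (RatF F N))) (f : RatF F N) (n : ℕ) :
    (applyOp P f).coeff n = P.coeff n f := by
  rw [applyOp, Polynomial.sum, Polynomial.finsetSum_coeff]
  simp only [Polynomial.coeff_monomial]
  rw [Finset.sum_ite_eq']
  split_ifs with h
  · rfl
  · rw [Polynomial.notMem_support_iff.1 h, LinearMap.zero_apply]

end Shift

/-! ### Expansion of the operator into shifts -/

section Expansion

variable {F : Type*} [Field F] (q : Fˣ) (t : F) {N : ℕ}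

/-- The factor of the terms of column `j` with (`b = true`) or without (`b = false`) shift which
is common to all rows. -/
def columnUnit (b : Bool) (j : Fin N) : Polynomial (RatF F N) :=
  if b then Polynomial.C (algebraMap F (RatF F N) t ^ (1 - (N : ℤ)) - (xv F j)⁻¹) * Polynomial.X
  else 1 + Polynomial.C (xv F j)⁻¹ * Polynomial.X

/-- The quantity whose powers appear in the terms of column `j`. -/
def columnVar (b : Bool) (j : Fin N) : RatF F N :=
  if b then algebraMap F (RatF F N) t * xv F j else xv F j

/-- The coefficient of the shift by `q ^ β` in `D_N(z; q, t)`. -/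
def shiftCoeff (β : Fin N → Bool) : Polynomial (RatF F N) :=
  (∏ j, columnUnit t (β j) j) *
    Polynomial.C ((vandermondeProd F N)⁻¹ * diffProd fun j => columnVar t (β j) j)

theorem xv_ne_zero (j : Fin N) : xv F j ≠ 0 := by
  rw [xv, Ne, FaithfulSMul.algebraMap_eq_zero_iff]
  exact X_ne_zero j

theorem vandermondeProd_eq_algebraMap :
    vandermondeProd F N = algebraMap (MvPolynomial (Fin N) F) _ (diffProd X) := by
  rw [map_diffProd]; rfl

theorem vandermondeProd_ne_zero : vandermondeProd F N ≠ 0 := by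
  rw [vandermondeProd_eq_algebraMap, Ne, FaithfulSMul.algebraMap_eq_zero_iff]
  exact diffProd_X_ne_zero

/-- This is the form required by `columnDet_sum`: the row enters only through the power of
`columnVar`. -/
theorem entry_eq (i j : Fin N) :
    entry q t i j = ∑ b : Bool,
      polyMul F N (columnUnit t b j * Polynomial.C (columnVar t b j) ^ (N - ((i : ℕ) + 1))) *
        Polynomial.C (shiftOp (if b then Function.update 1 j q else 1)) := by
  have hx := xv_ne_zero (F := F) j
  have h1 : (shiftOp 1 : Module.End F (RatF F N)) = 1 := (shiftMonoidHom F N).map_one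
  have hM : ∀ g : RatF F N, Polynomial.C (mulHom F N g) = polyMul F N (Polynomial.C g) :=
    fun g => (Polynomial.map_C _).symm
  have hX : (Polynomial.X : Polynomial (Module.End F (RatF F N))) = polyMul F N Polynomial.X :=
    (Polynomial.map_X _).symm
  rw [Fintype.sum_bool, if_pos rfl, if_neg Bool.false_ne_true, h1, Polynomial.C_1, mul_one, entry]
  simp only [mulOp_eq, qShift_eq_shiftOp]
  rw [mul_add, ← mul_assoc]
  simp only [hM]
  rw [hX]
  simp only [← map_mul, ← map_add, ← mul_assoc]
  simp only [columnUnit, columnVar, if_true, Bool.false_eq_true, if_false, ← Polynomial.C_pow]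
  have hCx : Polynomial.C (xv F j)⁻¹ * Polynomial.C (xv F j) = 1 := by
    rw [← Polynomial.C_mul, inv_mul_cancel₀ hx, Polynomial.C_1]
  congr 3
  · simp only [mul_pow, Polynomial.C_mul, Polynomial.C_sub, Polynomial.C_1]
    linear_combination (Polynomial.C (algebraMap F (RatF F N) t ^ (1 - (N : ℤ))) * Polynomial.X *
      Polynomial.C (xv F j ^ (N - ((i : ℕ) + 1))) *
      Polynomial.C (algebraMap F (RatF F N) t ^ (N - ((i : ℕ) + 1)))) * hCx
  · rw [mul_add, hCx]

theorem prod_update_eq_indPow (β : Fin N → Bool) :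
    ∏ j : Fin N, (if β j then Function.update 1 j q else 1 : Fin N → Fˣ) = indPow q β := by
  funext k
  rw [Finset.prod_apply, Finset.prod_eq_single k]
  · rw [indPow]
    split_ifs <;> simp
  · intro j _ hj
    split_ifs
    · simp [Function.update_of_ne hj.symm]
    · rfl
  · exact fun hn => absurd (Finset.mem_univ _) hn

/-- `shiftOp` with values in the operators depending polynomially on `z`. -/
def polyShiftOp (F : Type*) [Field F] (N : ℕ) :
    (Fin N → Fˣ) →* Polynomial (Module.End F (RatF F N)) :=
  (Polynomial.C : Module.End F (RatF F N) →+* _).toMonoidHom.comp (shiftMonoidHom F N)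

theorem list_prod_shiftOp (β : Fin N → Bool) :
    (List.ofFn fun j => Polynomial.C (shiftOp (F := F)
      (if β j then Function.update 1 j q else 1))).prod =
      Polynomial.C (shiftOp (indPow q β)) := by
  have h := prod_ofFn_map (polyShiftOp F N)
    fun j : Fin N => (if β j then Function.update 1 j q else 1 : Fin N → Fˣ)
  rw [prod_update_eq_indPow] at h
  exact h

theorem commute_shift_entry {i j : Fin N} (hij : i ≠ j) (m : ℕ) (b c : Bool) :
    Commute (Polynomial.C (shiftOp (if b then Function.update 1 i q else 1)))
      (polyMul F N (columnUnit t c j * Polynomial.C (columnVar t c j) ^ m)) := by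
  refine commute_shiftOp_polyMul ?_
  have hx : shift (if b then Function.update 1 i q else 1) (xv F j) = xv F j := by
    rw [shift_xv]
    split_ifs <;> simp [Function.update_of_ne hij.symm]
  have hC : ∀ a : F, shift (if b then Function.update 1 i q else 1)
      (algebraMap F (RatF F N) a) = algebraMap F _ a := fun a => AlgEquiv.commutes _ a
  rw [Polynomial.map_mul, Polynomial.map_pow, Polynomial.map_C, columnUnit, columnVar]
  cases c <;> simp [hx, hC]

theorem opD_eq : opD q t N =
    ∑ β : Fin N → Bool, polyMul F N (shiftCoeff t β) * Polynomial.C (shiftOp (indPow q β)) := by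
  have hM : ∀ g : RatF F N, Polynomial.C (mulOp g) = polyMul F N (Polynomial.C g) :=
    fun g => (Polynomial.map_C (mulHom F N)).symm
  have hentry : entry q t (N := N) = fun i j : Fin N => ∑ b : Bool,
      polyMul F N (columnUnit t b j * Polynomial.C (columnVar t b j) ^ (N - ((i : ℕ) + 1))) *
        Polynomial.C (shiftOp (if b then Function.update 1 j q else 1)) :=
    funext fun i => funext fun j => entry_eq q t i j
  rw [opD, hentry, columnDet_sum _ _ _ fun i j hij k b c =>
    commute_shift_entry q t hij _ b c, Finset.mul_sum]
  refine Finset.sum_congr rfl fun β _ => ?_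
  rw [list_prod_shiftOp, det_mul_pow_rev, hM, ← mul_assoc, ← map_mul, shiftCoeff,
    Polynomial.C_mul, map_diffProd]
  congr 2
  ring

theorem applyOp_opD (f : RatF F N) : applyOp (opD q t N) f =
    ∑ β : Fin N → Bool, shiftCoeff t β * Polynomial.C (shift (indPow q β) f) := by
  ext1 n
  rw [coeff_applyOp, opD_eq, Polynomial.finsetSum_coeff, Polynomial.finsetSum_coeff,
    LinearMap.sum_apply]
  refine Finset.sum_congr rfl fun β _ => ?_
  rw [coeff_polyMul_mul_C, Polynomial.coeff_mul_C]
  rfl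

theorem opDr_eq (r : ℕ) : opDr q t N r =
    ∑ β : Fin N → Bool, mulHom F N ((shiftCoeff t β).coeff r) * shiftOp (indPow q β) := by
  rw [opDr, opD_eq, Polynomial.finsetSum_coeff]
  simp only [coeff_polyMul_mul_C]

theorem natDegree_C_mul_X_le {R : Type*} [Semiring R] (a : R) :
    (Polynomial.C a * Polynomial.X).natDegree ≤ 1 := by
  simpa using Polynomial.natDegree_C_mul_X_pow_le a 1

theorem natDegree_columnUnit_le (b : Bool) (j : Fin N) : (columnUnit t b j).natDegree ≤ 1 := by
  rw [columnUnit]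
  split_ifs
  · exact natDegree_C_mul_X_le _
  · refine (Polynomial.natDegree_add_le _ _).trans (max_le ?_ (natDegree_C_mul_X_le _))
    simp

theorem opDr_eq_zero {r : ℕ} (hr : N < r) : opDr q t N r = 0 := by
  rw [opDr_eq]
  refine Finset.sum_eq_zero fun β _ => ?_
  rw [shiftCoeff, Polynomial.coeff_mul_C, Polynomial.coeff_eq_zero_of_natDegree_lt, zero_mul,
    map_zero, zero_mul]
  refine lt_of_le_of_lt ((Polynomial.natDegree_prod_le _ _).trans
    (Finset.sum_le_sum fun j _ => natDegree_columnUnit_le t (β j) j)) ?_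
  simpa using hr

/-- Every shift carries a factor `z`, so only the term without shifts survives at `z = 0`; there the
difference product cancels `V`. -/
theorem opDr_zero : opDr q t N 0 = 1 := by
  rw [opDr_eq, Finset.sum_eq_single (fun _ => false)]
  · have h1 : indPow (N := N) q (fun _ => false) = 1 := by
      funext j
      simp [indPow]
    have h2 : (shiftCoeff t (N := N) fun _ => false).coeff 0 = 1 := by
      rw [shiftCoeff, Polynomial.coeff_mul_C, Polynomial.coeff_zero_eq_eval_zero,
        Polynomial.eval_prod]
      simp [columnUnit, columnVar]
      exact inv_mul_cancel₀ vandermondeProd_ne_zero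
    rw [h1, h2, map_one, one_mul]
    exact (shiftMonoidHom F N).map_one
  · intro β _ hβ
    obtain ⟨k, hk⟩ : ∃ k, β k = true := by
      by_contra hne
      push Not at hne
      exact hβ (funext fun k => by simpa using hne k)
    have : (shiftCoeff t β).coeff 0 = 0 := by
      rw [shiftCoeff, Polynomial.coeff_mul_C, Polynomial.coeff_zero_eq_eval_zero,
        Polynomial.eval_prod, Finset.prod_eq_zero (Finset.mem_univ k), zero_mul]
      simp [columnUnit, hk]
    rw [this, map_zero, zero_mul]
  · exact fun hn => absurd (Finset.mem_univ _) hn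

theorem opD_eq_one_add_sum : opD q t N =
    1 + ∑ r ∈ Finset.Icc 1 N, Polynomial.C (opDr q t N r) * Polynomial.X ^ r := by
  ext1 n
  rw [Polynomial.coeff_add, Polynomial.finsetSum_coeff]
  simp only [Polynomial.coeff_C_mul_X_pow]
  rw [Finset.sum_ite_eq, Polynomial.coeff_one]
  change opDr q t N n = _
  rcases Nat.eq_zero_or_pos n with rfl | hn
  · simp [opDr_zero]
  · rw [if_neg hn.ne', zero_add]
    split_ifs with h
    · rfl
    · rw [opDr_eq_zero]
      rw [Finset.mem_Icc] at h
      omega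

/-! ### The eigenvalue equation -/

theorem eval_applyOp_opD (z : F) (f : MvPolynomial (Fin N) F) :
    (applyOp (opD q t N) (algebraMap _ (RatF F N) f)).eval (algebraMap F (RatF F N) z) =
      (vandermondeProd F N)⁻¹ * (∏ j, xv F j)⁻¹ *
        algebraMap _ (RatF F N) (numerator (q : F) t z f) := by
  have hC : ∀ a : F, algebraMap (MvPolynomial (Fin N) F) (RatF F N) (C a) = algebraMap F _ a :=
    fun a => by rw [← algebraMap_eq, ← IsScalarTower.algebraMap_apply]
  rw [applyOp_opD, Polynomial.eval_finsetSum, numerator, map_sum, Finset.mul_sum]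
  refine Finset.sum_congr rfl fun β _ => ?_
  have h1 : ∀ j, (columnUnit t (β j) j).eval (algebraMap F (RatF F N) z) =
      (xv F j)⁻¹ * algebraMap _ (RatF F N) (colFactor t z β j) := fun j => by
    have hx := xv_ne_zero (F := F) j
    rw [columnUnit, colFactor]
    split_ifs
    · simp only [Polynomial.eval_mul, Polynomial.eval_sub, Polynomial.eval_C, Polynomial.eval_X,
        map_mul, map_sub, hC,
        map_one, map_zpow₀]
      rw [← xv]
      field_simp
    · simp only [Polynomial.eval_mul, Polynomial.eval_C, Polynomial.eval_X, Polynomial.eval_add,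
        Polynomial.eval_one, map_add, hC]
      rw [← xv]
      field_simp
  have h2 : ∀ j, algebraMap _ (RatF F N) (scaledVar t β j) = columnVar t (β j) j := fun j => by
    rw [scaledVar, columnVar]
    split_ifs
    · rw [map_mul, hC]; rfl
    · rfl
  have h3 : (fun j => ((indPow q β j : Fˣ) : F)) = indPow (q : F) β := by
    funext j
    simp only [indPow]
    split_ifs <;> simp
  rw [Polynomial.eval_mul, Polynomial.eval_C, shiftCoeff, Polynomial.eval_mul, Polynomial.eval_C,
    Polynomial.eval_prod, shift_algebraMap, h3, map_mul, map_mul, map_prod, map_diffProd]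
  simp only [h1, h2]
  rw [Finset.prod_mul_distrib, Finset.prod_inv_distrib]
  ring

variable {q t}

theorem IsInterpolation.applyOp_opD_eq [CharZero F] (h : Generic q t) {μ : Fin N → ℕ}
    (hμ : Antitone μ) {f : MvPolynomial (Fin N) F} (hf : IsInterpolation q t μ f) :
    applyOp (opD q t N) (algebraMap _ (RatF F N) f) =
      (∏ i : Fin N, (1 + Polynomial.C (algebraMap F (RatF F N)
        ((q : F) ^ μ i * (t ^ (i : ℕ))⁻¹)) * Polynomial.X)) *
          Polynomial.C (algebraMap _ (RatF F N) f) := by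
  -- Both sides are polynomials in `z`, so it suffices to compare them at the infinitely many
  -- scalars `z` in `F`, where the numerator is available.
  have hinf : (Set.range (algebraMap F (RatF F N))).Infinite :=
    Set.infinite_range_of_injective (algebraMap F (RatF F N)).injective
  refine Polynomial.eq_of_infinite_eval_eq _ _ (hinf.mono ?_)
  rintro _ ⟨z, rfl⟩
  rw [Set.mem_ofPred_eq, eval_applyOp_opD, hf.numerator_eq h z hμ, map_mul, map_mul,
    ← vandermondeProd_eq_algebraMap, map_prod]
  have hV := vandermondeProd_ne_zero (F := F) (N := N)
  have hX : ∏ j, xv F (N := N) j ≠ 0 := Finset.prod_ne_zero_iff.2 fun j _ => xv_ne_zero j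
  change _ * (_ * (∏ j, xv F j) * _) = _
  rw [Polynomial.eval_mul, Polynomial.eval_C, Polynomial.eval_prod, smul_eq_C_mul, map_mul,
    ← algebraMap_eq, ← IsScalarTower.algebraMap_apply, map_prod]
  simp only [Polynomial.eval_add, Polynomial.eval_mul, Polynomial.eval_C, Polynomial.eval_X,
    Polynomial.eval_one, map_add, map_one, map_mul]
  rw [← mul_inv, inv_mul_cancel_left₀ (mul_ne_zero hV hX)]

end Expansion

/-! ### Commutation -/

section Commutation

variable {F : Type*} [Field F] {N : ℕ}

/-- The operators which are combinations of shifts, with rational functions as coefficients. -/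
def shiftSpan (F : Type*) [Field F] (N : ℕ) : Submodule (RatF F N) (Module.End F (RatF F N)) :=
  Submodule.span (RatF F N) (Set.range shiftOp)

theorem mulHom_mul_eq_smul (g : RatF F N) (a : Module.End F (RatF F N)) :
    mulHom F N g * a = g • a := rfl

theorem mul_mem_shiftSpan {a b : Module.End F (RatF F N)} (ha : a ∈ shiftSpan F N)
    (hb : b ∈ shiftSpan F N) : a * b ∈ shiftSpan F N := by
  induction ha using Submodule.span_induction with
  | zero => rw [zero_mul]; exact Submodule.zero_mem _
  | add x y _ _ hx hy => rw [add_mul]; exact Submodule.add_mem _ hx hy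
  | smul k x _ hx =>
    rw [← mulHom_mul_eq_smul, mul_assoc]
    exact Submodule.smul_mem _ k hx
  | mem x hx =>
    obtain ⟨c, rfl⟩ := hx
    induction hb using Submodule.span_induction with
    | zero => rw [mul_zero]; exact Submodule.zero_mem _
    | add x y _ _ hx hy => rw [mul_add]; exact Submodule.add_mem _ hx hy
    | smul k x _ hx =>
      -- A coefficient passes a shift at the price of being shifted itself.
      rw [← mulHom_mul_eq_smul, ← mul_assoc, shiftOp_mul_mulHom, mul_assoc]
      exact Submodule.smul_mem _ _ hx
    | mem x hx =>
      obtain ⟨d, rfl⟩ := hx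
      exact Submodule.subset_span ⟨c * d, (shiftMonoidHom F N).map_mul c d⟩

theorem opDr_mem_shiftSpan (q : Fˣ) (t : F) (r : ℕ) : opDr q t N r ∈ shiftSpan F N := by
  rw [opDr_eq]
  exact Submodule.sum_mem _ fun β _ => Submodule.smul_mem _ _ (Submodule.subset_span ⟨_, rfl⟩)

/-- A shift, restricted to the symmetric polynomials. -/
def symmShift (c : Fin N → Fˣ) : symmetricSubalgebra (Fin N) F →* RatF F N :=
  ((shift c : RatF F N →* RatF F N).comp
    (algebraMap (MvPolynomial (Fin N) F) (RatF F N) : MvPolynomial (Fin N) F →* RatF F N)).comp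
    ((symmetricSubalgebra (Fin N) F).val : symmetricSubalgebra (Fin N) F →* _)

theorem symmShift_apply (c : Fin N → Fˣ) (f : symmetricSubalgebra (Fin N) F) :
    symmShift c f = shift c (algebraMap (MvPolynomial (Fin N) F) _ f.1) := rfl

/-- The test polynomial `∏ (x_i - 1)` becomes `∏ (c_i x_i - 1)`; its vanishing at the point with
`x_k = c_k⁻¹` and zeros elsewhere recovers `c_k`. -/
theorem symmShift_injective : Function.Injective (symmShift (F := F) (N := N)) := by
  intro c d hcd
  obtain ⟨p, hp⟩ : ∃ p : symmetricSubalgebra (Fin N) F, p.1 = ∏ i, (X i - C 1) :=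
    ⟨⟨_, isSymmetric_prod_X_sub_C (σ := Fin N) (1 : F)⟩, rfl⟩
  have h1 := DFunLike.congr_fun hcd p
  rw [symmShift_apply, symmShift_apply, hp, shift_algebraMap, shift_algebraMap] at h1
  have h2 := IsFractionRing.injective (MvPolynomial (Fin N) F) (RatF F N) h1
  funext k
  have h3 := congrArg (eval (Function.update (0 : Fin N → F) k ((c k)⁻¹ : Fˣ))) h2
  rw [eval_scale, eval_scale, map_prod, map_prod, Finset.prod_eq_zero (Finset.mem_univ k)] at h3
  · obtain ⟨j, -, hj⟩ := Finset.prod_eq_zero_iff.1 h3.symm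
    rw [map_sub, eval_X, eval_C] at hj
    by_cases hjk : j = k
    · subst hjk
      rw [Function.update_self, ← Units.val_mul, sub_eq_zero, Units.val_eq_one] at hj
      exact (mul_inv_eq_one.1 hj).symm
    · simp [Function.update_of_ne hjk] at hj
  · simp

/-- Distinct shifts restrict to distinct characters of the multiplicative monoid of symmetric
polynomials, and distinct characters are linearly independent over `RatF F N`. Testing on symmetric
polynomials therefore determines all coefficients. -/
theorem eq_zero_of_mem_shiftSpan {a : Module.End F (RatF F N)} (ha : a ∈ shiftSpan F N)
    (h : ∀ f : MvPolynomial (Fin N) F, f.IsSymmetric → a (algebraMap _ _ f) = 0) : a = 0 := by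
  obtain ⟨c, rfl⟩ := (Finsupp.mem_span_range_iff_exists_finsupp).1 ha
  have hli := (linearIndependent_monoidHom (symmetricSubalgebra (Fin N) F) (RatF F N)).comp
    symmShift symmShift_injective
  have hc : c = 0 := by
    refine linearIndependent_iff.1 hli c ?_
    funext f
    have := h f.1 f.2
    rw [Finsupp.sum, LinearMap.sum_apply] at this
    rw [Finsupp.linearCombination_apply, Finsupp.sum, Finset.sum_apply]
    exact this
  rw [hc, Finsupp.sum_zero_index]

theorem IsInterpolation.exists_opDr_eq_smul [CharZero F] {q : Fˣ} {t : F} (h : Generic q t)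
    {μ : Fin N → ℕ} (hμ : Antitone μ) {f : MvPolynomial (Fin N) F} (hf : IsInterpolation q t μ f)
    (r : ℕ) : ∃ a : F, opDr q t N r (algebraMap _ (RatF F N) f) = a • algebraMap _ (RatF F N) f := by
  have key := congrArg (fun p => Polynomial.coeff p r) (hf.applyOp_opD_eq h hμ)
  simp only [coeff_applyOp, Polynomial.coeff_mul_C] at key
  -- The eigenvalue is taken in `F`, not in `RatF F N`, because the operators are only `F`-linear.
  refine ⟨(∏ i : Fin N, (1 + Polynomial.C ((q : F) ^ μ i * (t ^ (i : ℕ))⁻¹) *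
    Polynomial.X)).coeff r, ?_⟩
  rw [opDr, key, Algebra.smul_def, ← Polynomial.coeff_map, Polynomial.map_prod]
  simp

theorem opDr_commute [CharZero F] {q : Fˣ} {t : F} (h : Generic q t) (r s : ℕ) :
    Commute (opDr q t N r) (opDr q t N s) := by
  rw [commute_iff_eq, ← sub_eq_zero]
  refine eq_zero_of_mem_shiftSpan (Submodule.sub_mem _
    (mul_mem_shiftSpan (opDr_mem_shiftSpan q t r) (opDr_mem_shiftSpan q t s))
    (mul_mem_shiftSpan (opDr_mem_shiftSpan q t s) (opDr_mem_shiftSpan q t r))) fun f hf => ?_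
  let L : MvPolynomial (Fin N) F →ₗ[F] RatF F N :=
    (opDr q t N r * opDr q t N s - opDr q t N s * opDr q t N r).comp
      (IsScalarTower.toAlgHom F (MvPolynomial (Fin N) F) (RatF F N)).toLinearMap
  have hspan : Submodule.span F {g | ∃ μ : Fin N → ℕ, Antitone μ ∧ IsInterpolation q t μ g} ≤
      LinearMap.ker L := by
    rw [Submodule.span_le]
    rintro g ⟨μ, hμ, hg⟩
    obtain ⟨a, ha⟩ := hg.exists_opDr_eq_smul h hμ r
    obtain ⟨b, hb⟩ := hg.exists_opDr_eq_smul h hμ s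
    change opDr q t N r (opDr q t N s _) - opDr q t N s (opDr q t N r _) = 0
    erw [ha, hb]
    rw [map_smul, map_smul, ha, hb, smul_comm, sub_self]
  exact hspan (mem_span_isInterpolation h hf)

end Commutation

/-! ### The field `ℚ(q, t)` -/

theorem generic_qv_tv : Generic qv tv where
  ne_zero := by
    rw [tv, Ne, FaithfulSMul.algebraMap_eq_zero_iff]
    exact X_ne_zero 1
  eq_zero a b h := by
    have h1 : algebraMap (MvPolynomial (Fin 2) ℚ) QT (X 0 ^ a * X 1 ^ b) =
        algebraMap (MvPolynomial (Fin 2) ℚ) QT 1 := by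
      rw [map_mul, map_pow, map_pow, map_one]
      exact h
    -- Comparing total degrees gives `a + b = 0`.
    have h2 := congrArg totalDegree (IsFractionRing.injective (MvPolynomial (Fin 2) ℚ) QT h1)
    rw [totalDegree_mul_of_isDomain (pow_ne_zero _ (X_ne_zero _)) (pow_ne_zero _ (X_ne_zero _)),
      totalDegree_X_pow, totalDegree_X_pow, totalDegree_one] at h2
    omega

end InterpMacdonald

end

theorem theorem7 (N : ℕ) (hN : 1 ≤ N) :
    -- for every partition `μ` with at most `N` parts the interpolation polynomial exists,
    -- is unique up to a scalar factor, and is an eigenfunction of `D_N(z; q, t)`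
    (∀ μ : Fin N → ℕ, Antitone μ →
      (∃ f, InterpMacdonald.IsInterpolation InterpMacdonald.qv InterpMacdonald.tv μ f) ∧
      (∀ f g, InterpMacdonald.IsInterpolation InterpMacdonald.qv InterpMacdonald.tv μ f →
        InterpMacdonald.IsInterpolation InterpMacdonald.qv InterpMacdonald.tv μ g →
        ∃ c : InterpMacdonald.QT, c ≠ 0 ∧ g = c • f) ∧
      ∀ f, InterpMacdonald.IsInterpolation InterpMacdonald.qv InterpMacdonald.tv μ f →
        InterpMacdonald.applyOp (InterpMacdonald.opD InterpMacdonald.qv InterpMacdonald.tv N)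
            (algebraMap _ (InterpMacdonald.RatF InterpMacdonald.QT N) f) =
          (∏ i : Fin N, (1 + Polynomial.C (algebraMap InterpMacdonald.QT
              (InterpMacdonald.RatF InterpMacdonald.QT N)
              ((InterpMacdonald.qv : InterpMacdonald.QT) ^ μ i *
                (InterpMacdonald.tv ^ (i : ℕ))⁻¹)) * Polynomial.X)) *
            Polynomial.C (algebraMap _ (InterpMacdonald.RatF InterpMacdonald.QT N) f)) ∧
    -- `D_N(z; q, t) = 1 + ∑_{r = 1}^N D^r_N(q, t) z ^ r`
    InterpMacdonald.opD InterpMacdonald.qv InterpMacdonald.tv N =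
      1 + ∑ r ∈ Finset.Icc 1 N,
        Polynomial.C (InterpMacdonald.opDr InterpMacdonald.qv InterpMacdonald.tv N r) *
          Polynomial.X ^ r ∧
    -- the operators `D^1_N, …, D^N_N` commute
    (∀ r ∈ Finset.Icc 1 N, ∀ s ∈ Finset.Icc 1 N,
      Commute (InterpMacdonald.opDr InterpMacdonald.qv InterpMacdonald.tv N r)
        (InterpMacdonald.opDr InterpMacdonald.qv InterpMacdonald.tv N s)) := by
  have h := InterpMacdonald.generic_qv_tv
  exact ⟨fun μ hμ => ⟨InterpMacdonald.exists_isInterpolation h hμ,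
    fun f g hf hg => hf.unique h hg, fun f hf => hf.applyOp_opD_eq h hμ⟩,
    InterpMacdonald.opD_eq_one_add_sum _ _,
    fun r _ s _ => InterpMacdonald.opDr_commute h r s⟩
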